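/- Let $1\le n\le d$ be integers and let $\mu$ be a Borel measure on $\mathbb R^d$ such that, for some constant $C_0$, $\mu(B(x,s))\le C_0 s^n$ for all $x\in\mathbb R^d$, $s>0$. A *cube* is a closed cube $Q$ with sides parallel to the axes, centered at a point of $\operatorname{supp}\mu$ and of side length $l(Q)>0$; if $\mu(\mathbb R^d)<\infty$, then $Q=\mathbb R^d$ is also a cube, with $l(\mathbb R^d)=\infty$. For $k\ge0$, $2^kQ$ is the concentric cube of side length $2^kl(Q)$ (and $2^k\mathbb R^d=\mathbb R^d$). For cubes $Q\subset R$ put $$K_{Q,R}=1+\sum_{k=1}^{N_{Q,R}}\frac{\mu(2^kQ)}{l(2^kQ)^n},$$ where $N_{Q,R}$ is the first integer $k\ge0$ with $l(2^kQ)\ge l(R)$ ($N_{Q,R}=\infty$ if $R=\mathbb R^d\ne Q$). Fix $\beta>2^d$. A cube $Q$ is *doubling* if $\mu(2Q)\le\beta\,\mu(Q)$; for a cube $Q$ let $\widetilde Q=2^NQ$, with $N\ge0$ the smallest integer for which $2^NQ$ is doubling. Write $m_Qf=\mu(Q)^{-1}\int_Qf\,d\mu$. Functions are scalar valued (all real or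 all complex). A function $f\in L^1_{loc}(\mu)$ is in $RBMO(\mu)$ if for some constant $C\ge0$ $$\int_Q|f-m_{\widetilde Q}f|\,d\mu\le C\,\mu(2Q)\ \text{ for every cube }Q,\qquad |m_Qf-m_Rf|\le C\,K_{Q,R}\ \text{ for all doubling cubes }Q\subset R,$$ and $\|f\|_*$ is the smallest such $C$. **Theorem.** Let $1<p<\infty$ and let $T$ be a bounded linear operator on $L^p(\mu)$ which is bounded from $L^\infty(\mu)$ into $RBMO(\mu)$, in the sense that there is a constant $A$ such that, for all $f\in L^p(\mu)\cap L^\infty(\mu)$, $Tf\in RBMO(\mu)$ and $\|Tf\|_*\le A\|f\|_{L^\infty(\mu)}$. Then $T$ extends boundedly to $L^r(\mu)$ for every $p<r<\infty$: there is a bounded linear operator $S$ on $L^r(\mu)$ with $Sf=Tf$ $\mu$-a.e. for all $f\in L^p(\mu)\cap L^r(\mu)$. -/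

import Mathlib

open MeasureTheory Set
open scoped ENNReal

noncomputable section

/-- The admissible cubes for a measure `μ` on `ℝ^d`: cubes `box c _ l _` with center `c` in the
support of `μ` and side length `l > 0` (sides parallel to the axes), and, when `μ` is a finite
measure, also the whole space. -/
inductive Cube {d : ℕ} (μ : Measure (EuclideanSpace ℝ (Fin d))) : Type
  | box (c : EuclideanSpace ℝ (Fin d)) (hc : c ∈ μ.support) (l : ℝ) (hl : 0 < l) : Cube μ
  | whole (h : μ univ < ∞) : Cube μ

namespace Cube

variable {d : ℕ} {μ : Measure (EuclideanSpace ℝ (Fin d))}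

/-- The closed set of points of a cube. -/
def toSet : Cube μ → Set (EuclideanSpace ℝ (Fin d))
  | box c _ l _ => {y | ∀ i, |y i - c i| ≤ l / 2}
  | whole _ => univ

/-- The concentric cube `2^k Q`, whose side length is `2^k` times that of `Q`. -/
def dilate (Q : Cube μ) (k : ℕ) : Cube μ :=
  match Q with
  | box c hc l hl => box c hc (2 ^ k * l) (by positivity)
  | whole h => whole h

/-- `Q` is `(2, β)`-doubling: `μ(2Q) ≤ β μ(Q)`. -/
def IsDoubling (β : ℝ) (Q : Cube μ) : Prop :=
  μ (Q.dilate 1).toSet ≤ ENNReal.ofReal β * μ Q.toSet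

/-- The cube `Q̃ = 2^N Q`, with `N` the smallest integer `≥ 0` such that `2^N Q` is doubling. -/
def tilde (β : ℝ) (Q : Cube μ) : Cube μ :=
  Q.dilate (sInf {N : ℕ | (Q.dilate N).IsDoubling β})

/-- The coefficient `K_{Q,R} = 1 + ∑_{k=1}^{N_{Q,R}} μ(2^k Q) / l(2^k Q)^n`, where `N_{Q,R}` is the
first integer `k ≥ 0` with `l(2^k Q) ≥ l(R)`; `N_{Q,R} = ∞` if `R` is the whole space and `Q` is
not, and `N_{Q,R} = 0` if both are the whole space. It is only used for `Q ⊆ R`. -/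
def coeffK (n : ℕ) : Cube μ → Cube μ → ℝ
  | box c hc l hl, box _ _ l' _ =>
      1 + ∑ k ∈ Finset.Icc 1 (sInf {k : ℕ | l' ≤ 2 ^ k * l}),
        μ.real ((box c hc l hl).dilate k).toSet / (2 ^ k * l) ^ n
  | box c hc l hl, whole _ =>
      1 + ∑' k : ℕ, μ.real ((box c hc l hl).dilate (k + 1)).toSet / (2 ^ (k + 1) * l) ^ n
  | whole _, _ => 1

end Cube

/-- `f ∈ L¹_loc(μ)` satisfies the two defining conditions of `RBMO(μ)` with the constant `C`.
The mean `m_Q f` is `⨍ x in Q, f x ∂μ`. -/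
def RBMOWith {𝕜 : Type*} [RCLike 𝕜] {d : ℕ} (μ : Measure (EuclideanSpace ℝ (Fin d)))
    (n : ℕ) (β : ℝ) (f : EuclideanSpace ℝ (Fin d) → 𝕜) (C : ℝ) : Prop :=
  LocallyIntegrable f μ ∧
  (∀ Q : Cube μ, ∫⁻ x in Q.toSet, ‖f x - ⨍ y in (Q.tilde β).toSet, f y ∂μ‖ₑ ∂μ
      ≤ ENNReal.ofReal C * μ (Q.dilate 1).toSet) ∧
  (∀ Q R : Cube μ, Q.IsDoubling β → R.IsDoubling β → Q.toSet ⊆ R.toSet →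
    ‖(⨍ y in Q.toSet, f y ∂μ) - ⨍ y in R.toSet, f y ∂μ‖ ≤ C * Q.coeffK n R)

/-- `f` belongs to `RBMO(μ)`. -/
def MemRBMO {𝕜 : Type*} [RCLike 𝕜] {d : ℕ} (μ : Measure (EuclideanSpace ℝ (Fin d)))
    (n : ℕ) (β : ℝ) (f : EuclideanSpace ℝ (Fin d) → 𝕜) : Prop :=
  ∃ C : ℝ, 0 ≤ C ∧ RBMOWith μ n β f C

/-- The norm `‖f‖_*` of `RBMO(μ)`: the smallest constant in the two defining conditions. -/
def rbmoNorm {𝕜 : Type*} [RCLike 𝕜] {d : ℕ} (μ : Measure (EuclideanSpace ℝ (Fin d)))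
    (n : ℕ) (β : ℝ) (f : EuclideanSpace ℝ (Fin d) → 𝕜) : ℝ :=
  sInf {C : ℝ | 0 ≤ C ∧ RBMOWith μ n β f C}

end

/-!
The operator `T` is interpolated between `L^p → L^p` and `L^∞ → RBMO` through a good-`λ`
inequality for a maximal function; no sharp maximal function is needed.

For a function `f` let `N f (x)` be the supremum of `|m_Q f|` over the *doubling* cubes `Q` with
center `x`. By Besicovitch's covering theorem `N` is of weak type `(q, q)`
(`HasGrowth.measure_levelSet_le`). As `β > 2^d`, almost every point is the center of arbitrarily
small doubling cubes (`HasGrowth.ae_frequently_isDbl`), so that `|f| ≤ N f` almost everywhere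
(`HasGrowth.ae_mem_levelSet`).

If `f` is in `RBMO` with constant `K`, then `μ{N f > 4t} ≤ (cK/t) μ{N f > t}`
(`HasOsc.measure_levelSet_le`). Indeed, for `x` in the set on the left choose an almost maximal
doubling cube `Q` centered at `x` with `|m_Q f| > 2t`, and let `S` be the next doubling cube among
`2Q, 4Q, …`. The coefficients `K_{Q,R}` of `RBMO` stay bounded when `R` is the smallest doubling
cube among the `2^k P`, for `P ⊇ Q` of comparable size (`HasGrowth.sum_le`): below `R` the cubes
`2^k P` are not doubling, and the ratios `μ(2^k P) / l(2^k P)^n` decay geometrically. Hence the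
means of `f` over `Q`, over `S`, and over doubling cubes of size comparable to `S` centered at
other points of `S` differ by `O(K)`. Therefore `S` lies in `{N f > t}` up to a null set,
`|m_S f| ≤ 2t`, and the cubes responsible for the points of `S` with `N f > 4t` have less than half
the side length of `S`. The weak type `(1, 1)` inequality for `f - m_S f` on `(3/2) S`, together
with `∫_{(3/2) S} |f - m_S f| ≤ cK μ(S)` (`HasOsc.setLIntegral_le`), bounds the measure of these
points by `(cK/t) μ(S)`. Besicovitch's theorem sums this over `S`.

For `T f` one splits `f`, at height `s`, into its part below `δs` and the tail. For the image of the
first part the inequality above has a small constant, and the image of the tail is controlled by the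
`L^p` bound (`HasGrowth.exists_goodLambda`). Almost maximal cubes exist for a function `g` under the
condition `t^p μ(ℝ^d) > ‖g‖_p^p`, which is void if `μ` is infinite; if `μ` is finite, the
heights at which it fails are dominated by the tail (`measure_univ_le_tail`). Integrating against
`s^{r-1}` gives `‖T f‖_r ≤ D ‖f‖_r` on `L^p` (`HasGrowth.exists_lintegral_rpow_le`), and the
extension to `L^r` follows by density (`exists_extension`).
-/

open Filter Topology Metric

namespace RBMO

variable {d : ℕ}

/-! ### Cubes and the Besicovitch covering theorem -/

/-- The closed cube with center `c` and side length `l`, sides parallel to the axes. -/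
def cube (c : EuclideanSpace ℝ (Fin d)) (l : ℝ) : Set (EuclideanSpace ℝ (Fin d)) :=
  {y | ∀ i, |y i - c i| ≤ l / 2}

/-- Cubes are the closed balls of the sup norm. -/
lemma cube_eq_preimage (c : EuclideanSpace ℝ (Fin d)) {l : ℝ} (hl : 0 ≤ l) :
    cube c l = WithLp.ofLp ⁻¹' closedBall (WithLp.ofLp c) (l / 2) := by
  ext y
  simp only [cube, mem_ofPred_eq, mem_preimage, mem_closedBall]
  rw [dist_pi_le_iff (by positivity)]
  simp [Real.dist_eq]

lemma isClosed_cube (c : EuclideanSpace ℝ (Fin d)) (l : ℝ) : IsClosed (cube c l) := by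
  simp only [cube, ofPred_forall]
  exact isClosed_iInter fun i => isClosed_le (by fun_prop) continuous_const

lemma measurableSet_cube (c : EuclideanSpace ℝ (Fin d)) (l : ℝ) : MeasurableSet (cube c l) :=
  (isClosed_cube c l).measurableSet

lemma cube_subset {x z : EuclideanSpace ℝ (Fin d)} {l L : ℝ}
    (h : ∀ i, |x i - z i| ≤ (L - l) / 2) : cube x l ⊆ cube z L := by
  intro y hy i
  have h1 := hy i
  have h2 := h i
  have h3 := abs_sub_le (y i) (x i) (z i)
  linarith

lemma cube_mono (x : EuclideanSpace ℝ (Fin d)) {l L : ℝ} (h : l ≤ L) : cube x l ⊆ cube x L :=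
  cube_subset fun i => by simp; linarith

lemma cube_mem_nhds (x : EuclideanSpace ℝ (Fin d)) {l : ℝ} (hl : 0 < l) : cube x l ∈ 𝓝 x := by
  rw [cube_eq_preimage x hl.le]
  exact (PiLp.continuous_ofLp 2 _).continuousAt.preimage_mem_nhds
    (closedBall_mem_nhds _ (by positivity))

/-- Besicovitch's covering theorem for cubes of bounded side length: boundedly many disjoint
families of the cubes cover the set of their centers. -/
lemma exists_disjoint_covering_cubes (d : ℕ) : ∃ B : ℕ, ∀ (A : Set (EuclideanSpace ℝ (Fin d)))
    (l : EuclideanSpace ℝ (Fin d) → ℝ) (L : ℝ), (∀ x ∈ A, 0 < l x ∧ l x ≤ L) →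
    ∃ s : Fin B → Set (EuclideanSpace ℝ (Fin d)), (∀ i, s i ⊆ A) ∧ (∀ i, (s i).Countable) ∧
      (∀ i, (s i).PairwiseDisjoint fun x => cube x (l x)) ∧
      A ⊆ ⋃ i, ⋃ x ∈ s i, cube x (l x) := by
  obtain ⟨B, τ, hτ, hB⟩ := HasBesicovitchCovering.no_satelliteConfig (α := Fin d → ℝ)
  refine ⟨B, fun A l L hl => ?_⟩
  let q : Besicovitch.BallPackage A (Fin d → ℝ) :=
    { c := fun x => WithLp.ofLp x.1
      r := fun x => l x.1 / 2
      rpos := fun x => half_pos (hl x x.2).1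
      r_bound := L / 2
      r_le := fun x => by have := (hl x x.2).2; linarith }
  obtain ⟨s, hs, hcov⟩ := Besicovitch.exist_disjoint_covering_families hτ hB q
  have hcube : ∀ x : A, cube x.1 (l x.1) = WithLp.ofLp ⁻¹' closedBall (q.c x) (q.r x) :=
    fun x => cube_eq_preimage _ (hl x x.2).1.le
  have hdisj : ∀ i, (Subtype.val '' s i).PairwiseDisjoint fun x => cube x (l x) := by
    rintro i _ ⟨x, hx, rfl⟩ _ ⟨y, hy, rfl⟩ hxy
    have h := hs i hx hy (fun h => hxy (congrArg _ h))
    simp only [Function.onFun]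
    rw [hcube, hcube]
    exact Disjoint.preimage _ h
  refine ⟨fun i => Subtype.val '' s i, fun i => by simp, fun i => ?_, hdisj, ?_⟩
  · refine (hdisj i).countable_of_nonempty_interior ?_
    rintro _ ⟨x, hx, rfl⟩
    exact ⟨x, mem_interior_iff_mem_nhds.2 (cube_mem_nhds _ (hl x x.2).1)⟩
  · intro x hx
    have := hcov ⟨⟨x, hx⟩, rfl⟩
    simp only [mem_iUnion] at this
    obtain ⟨i, j, hj, hxj⟩ := this
    simp only [mem_iUnion]
    refine ⟨i, j, ⟨j, hj, rfl⟩, ?_⟩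
    rw [hcube]
    exact ball_subset_closedBall hxj

/-- `B` is a constant for the measure form of the Besicovitch covering theorem in dimension `d`: if
each point of `A` is the center of a cube inside `U` on which `A` has `μ`-measure at most the
`ν`-measure of the cube, then `μ A ≤ B ν U`. The sets `A` and `U` need not be measurable. -/
def IsCoveringConst (d : ℕ) (B : ℝ) : Prop :=
  ∀ (μ ν : Measure (EuclideanSpace ℝ (Fin d))) (A U : Set (EuclideanSpace ℝ (Fin d))),
    (∀ x ∈ A, ∃ l, 0 < l ∧ cube x l ⊆ U ∧ μ (A ∩ cube x l) ≤ ν (cube x l)) →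
    μ A ≤ ENNReal.ofReal B * ν U

lemma exists_isCoveringConst (d : ℕ) : ∃ B : ℝ, 0 ≤ B ∧ IsCoveringConst d B := by
  obtain ⟨B, hB⟩ := exists_disjoint_covering_cubes d
  refine ⟨B, by positivity, fun μ ν A U hA => ?_⟩
  choose! l hl0 hlU hlν using hA
  -- The covering theorem needs bounded side lengths, so `A` is exhausted by the parts of bounded
  -- side length.
  have key : ∀ k : ℕ, μ (A ∩ {x | l x ≤ k}) ≤ B * ν U := by
    intro k
    obtain ⟨s, hsA, hsc, hsd, hcov⟩ := hB (A ∩ {x | l x ≤ k}) l k fun x hx => ⟨hl0 x hx.1, hx.2⟩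
    calc μ (A ∩ {x | l x ≤ k})
        ≤ μ (⋃ i, ⋃ x ∈ s i, A ∩ cube x (l x)) := by
          refine measure_mono fun x hx => ?_
          have := hcov hx
          simp only [mem_iUnion] at this ⊢
          obtain ⟨i, j, hj, hxj⟩ := this
          exact ⟨i, j, hj, hx.1, hxj⟩
      _ ≤ ∑ i, μ (⋃ x ∈ s i, A ∩ cube x (l x)) := by
          simpa using measure_iUnion_le (μ := μ) fun i => ⋃ x ∈ s i, A ∩ cube x (l x)
      _ ≤ ∑ _i : Fin B, ν U := by
          refine Finset.sum_le_sum fun i _ => ?_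
          calc μ (⋃ x ∈ s i, A ∩ cube x (l x)) ≤ ∑' x : s i, μ (A ∩ cube x (l x)) :=
                measure_biUnion_le _ (hsc i) _
            _ ≤ ∑' x : s i, ν (cube x (l x)) := ENNReal.tsum_le_tsum fun x => hlν _ (hsA i x.2).1
            _ = ν (⋃ x ∈ s i, cube x (l x)) :=
                (measure_biUnion (hsc i) (hsd i) fun _ _ => measurableSet_cube _ _).symm
            _ ≤ ν U := measure_mono (iUnion₂_subset fun x hx => hlU x (hsA i hx).1)
      _ = B * ν U := by simp
  have hU : A = ⋃ k : ℕ, A ∩ {x | l x ≤ k} := by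
    ext x
    simp only [mem_iUnion, mem_inter_iff, mem_ofPred_eq, exists_and_left, iff_self_and]
    exact fun _ => exists_nat_ge (l x)
  have hmono : Monotone fun k : ℕ => A ∩ {x | l x ≤ k} := fun i j hij x hx =>
    ⟨hx.1, (show l x ≤ i from hx.2).trans (Nat.cast_le.2 hij)⟩
  rw [hU, hmono.measure_iUnion, ENNReal.ofReal_natCast]
  exact iSup_le key

/-! ### Doubling cubes and the coefficients `K` -/

/-- The growth condition `μ(Q) ≤ C l(Q)^n`, for all cubes. -/
def HasGrowth (μ : Measure (EuclideanSpace ℝ (Fin d))) (n : ℕ) (C : ℝ) : Prop :=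
  ∀ x l, 0 < l → μ (cube x l) ≤ ENNReal.ofReal (C * l ^ n)

/-- The cube with center `x` and side length `l` is `(2, β)`-doubling. -/
def IsDbl (μ : Measure (EuclideanSpace ℝ (Fin d))) (β : ℝ) (x : EuclideanSpace ℝ (Fin d))
    (l : ℝ) : Prop :=
  μ (cube x (2 * l)) ≤ ENNReal.ofReal β * μ (cube x l)

/-- The exponent `N` for which `2^N Q` is the smallest doubling cube among `Q, 2Q, 4Q, …`, where
`Q` has center `x` and side length `l`. -/
noncomputable def dblExp (μ : Measure (EuclideanSpace ℝ (Fin d))) (β : ℝ)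
    (x : EuclideanSpace ℝ (Fin d)) (l : ℝ) : ℕ :=
  sInf {N : ℕ | IsDbl μ β x (2 ^ N * l)}

/-- The side length of the smallest doubling cube among `Q, 2Q, 4Q, …`, where `Q` has center `x`
and side length `l`. -/
noncomputable def dblSide (μ : Measure (EuclideanSpace ℝ (Fin d))) (β : ℝ)
    (x : EuclideanSpace ℝ (Fin d)) (l : ℝ) : ℝ :=
  2 ^ dblExp μ β x l * l

section

variable {μ : Measure (EuclideanSpace ℝ (Fin d))} {n : ℕ} {C β l : ℝ}
  {x z : EuclideanSpace ℝ (Fin d)}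

lemma exists_hasGrowth (hn : 1 ≤ n) (hnd : n ≤ d)
    (hμ : ∃ C₀ : ℝ, ∀ (x : EuclideanSpace ℝ (Fin d)) (s : ℝ), 0 < s →
      μ (Metric.ball x s) ≤ ENNReal.ofReal (C₀ * s ^ n)) : ∃ C, 0 ≤ C ∧ HasGrowth μ n C := by
  obtain ⟨C₀, hC₀⟩ := hμ
  refine ⟨|C₀| * (d : ℝ) ^ n, by positivity, fun x l hl => ?_⟩
  have hd : (1 : ℝ) ≤ d := by exact_mod_cast hn.trans hnd
  have hsub : cube x l ⊆ ball x (d * l) := by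
    intro y hy
    rw [mem_ball, EuclideanSpace.dist_eq]
    have h1 : ∑ i, dist (y i) (x i) ^ 2 ≤ ∑ _i : Fin d, (l / 2) ^ 2 := by
      refine Finset.sum_le_sum fun i _ => ?_
      rw [Real.dist_eq]
      exact pow_le_pow_left₀ (abs_nonneg _) (hy i) 2
    rw [Finset.sum_const, Finset.card_univ, Fintype.card_fin, nsmul_eq_mul] at h1
    rw [Real.sqrt_lt' (by positivity)]
    have : (0 : ℝ) < l ^ 2 := by positivity
    nlinarith
  refine (measure_mono hsub).trans ((hC₀ x (d * l) (by positivity)).trans ?_)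
  refine ENNReal.ofReal_le_ofReal ?_
  rw [mul_assoc, ← mul_pow]
  exact mul_le_mul_of_nonneg_right (le_abs_self _) (by positivity)

lemma HasGrowth.measure_cube_lt_top (h : HasGrowth μ n C) (x : EuclideanSpace ℝ (Fin d)) (l : ℝ) :
    μ (cube x l) < ∞ :=
  (measure_mono (cube_mono x (le_max_left l 1))).trans_lt
    ((h x (max l 1) (by positivity)).trans_lt ENNReal.ofReal_lt_top)

lemma HasGrowth.isLocallyFiniteMeasure (h : HasGrowth μ n C) : IsLocallyFiniteMeasure μ :=
  ⟨fun x => ⟨cube x 1, cube_mem_nhds x one_pos, h.measure_cube_lt_top x 1⟩⟩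

lemma measure_cube_pos (hx : x ∈ μ.support) (hl : 0 < l) : 0 < μ (cube x l) :=
  (Measure.mem_support_iff_forall x).1 hx _ (cube_mem_nhds x hl)

lemma HasGrowth.real_le (h : HasGrowth μ n C) (hC : 0 ≤ C) (x : EuclideanSpace ℝ (Fin d))
    (hl : 0 < l) : μ.real (cube x l) ≤ C * l ^ n :=
  ENNReal.toReal_le_of_le_ofReal (by positivity) (h x l hl)

lemma HasGrowth.isDbl_iff (h : HasGrowth μ n C) (hβ : 0 ≤ β) :
    IsDbl μ β x l ↔ μ.real (cube x (2 * l)) ≤ β * μ.real (cube x l) := by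
  have h1 : β * μ.real (cube x l) = (ENNReal.ofReal β * μ (cube x l)).toReal := by
    rw [ENNReal.toReal_mul, ENNReal.toReal_ofReal hβ, Measure.real]
  rw [IsDbl, h1, Measure.real, ENNReal.toReal_le_toReal (h.measure_cube_lt_top _ _).ne
    (ENNReal.mul_ne_top ENNReal.ofReal_ne_top (h.measure_cube_lt_top _ _).ne)]

lemma pow_mul_le_of_step {a : ℕ → ℝ} (hβ : 0 ≤ β) {N : ℕ}
    (ha : ∀ j < N, β * a j ≤ a (j + 1)) (i : ℕ) (hi : i ≤ N) : β ^ i * a (N - i) ≤ a N := by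
  induction i with
  | zero => simp
  | succ i ih =>
    have h1 := ha (N - (i + 1)) (by omega)
    rw [show N - (i + 1) + 1 = N - i by omega] at h1
    calc β ^ (i + 1) * a (N - (i + 1)) = β ^ i * (β * a (N - (i + 1))) := by ring
      _ ≤ β ^ i * a (N - i) := mul_le_mul_of_nonneg_left h1 (by positivity)
      _ ≤ a N := ih (by omega)

lemma two_pow_lt (hnd : n ≤ d) (hβ : 2 ^ d < β) : 2 ^ n < β :=
  (pow_le_pow_right₀ one_le_two hnd).trans_lt hβ

/-- Some cube among `Q, 2Q, 4Q, …` is doubling: otherwise `μ(2^N Q)` would grow at least like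
`β^N`, against the growth condition. -/
lemma HasGrowth.exists_isDbl (h : HasGrowth μ n C) (hC : 0 ≤ C) (hβ : 2 ^ n < β)
    (hx : x ∈ μ.support) (hl : 0 < l) : ∃ N : ℕ, IsDbl μ β x (2 ^ N * l) := by
  by_contra! hcon
  have hβ0 : 0 < β := lt_trans (by positivity) hβ
  set a : ℕ → ℝ := fun N => μ.real (cube x (2 ^ N * l)) with ha
  have ha0 : 0 < a 0 := by
    simp only [ha, pow_zero, one_mul]
    exact ENNReal.toReal_pos (measure_cube_pos hx hl).ne' (h.measure_cube_lt_top _ _).ne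
  have hstep : ∀ j, β * a j ≤ a (j + 1) := by
    intro j
    have := hcon j
    rw [h.isDbl_iff hβ0.le, not_le, ← mul_assoc, ← pow_succ'] at this
    exact this.le
  obtain ⟨N, hN⟩ := pow_unbounded_of_one_lt (C * l ^ n / a 0)
    ((one_lt_div (by positivity)).2 hβ : 1 < β / 2 ^ n)
  have h1 := pow_mul_le_of_step hβ0.le (fun j (_ : j < N) => hstep j) N le_rfl
  have h2 : a N ≤ C * (2 ^ N * l) ^ n := h.real_le hC x (by positivity)
  rw [Nat.sub_self] at h1
  rw [div_lt_iff₀ ha0, div_pow, div_mul_eq_mul_div, lt_div_iff₀ (by positivity)] at hN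
  have h3 : C * (2 ^ N * l) ^ n = C * l ^ n * (2 ^ n) ^ N := by
    rw [mul_pow, ← pow_mul, ← pow_mul, mul_comm N n]; ring
  linarith

lemma HasGrowth.isDbl_dblSide (h : HasGrowth μ n C) (hC : 0 ≤ C) (hβ : 2 ^ n < β)
    (hx : x ∈ μ.support) (hl : 0 < l) : IsDbl μ β x (dblSide μ β x l) :=
  Nat.sInf_mem (h.exists_isDbl hC hβ hx hl)

lemma le_dblSide (hl : 0 < l) : l ≤ dblSide μ β x l :=
  le_mul_of_one_le_left hl.le (one_le_pow₀ one_le_two)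

lemma dblSide_pos (hl : 0 < l) : 0 < dblSide μ β x l := hl.trans_le (le_dblSide hl)

/-- Passing to `2^k Q` does not change the smallest doubling cube as long as `2^k Q` is not larger
than that cube. -/
lemma dblSide_two_pow_mul {k : ℕ} (hk : k ≤ dblExp μ β x l) :
    dblSide μ β x (2 ^ k * l) = dblSide μ β x l := by
  rcases Nat.eq_zero_or_pos k with rfl | hkpos
  · simp
  have hN : dblExp μ β x l ∈ {N : ℕ | IsDbl μ β x (2 ^ N * l)} := by
    refine Nat.sInf_mem ?_
    by_contra hne
    rw [not_nonempty_iff_eq_empty] at hne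
    rw [dblExp, hne, Nat.sInf_empty] at hk
    omega
  have hexp : dblExp μ β x (2 ^ k * l) = dblExp μ β x l - k := by
    apply le_antisymm
    · refine Nat.sInf_le ?_
      change IsDbl μ β x _
      rw [← mul_assoc, ← pow_add, Nat.sub_add_cancel hk]
      exact hN
    · refine le_csInf ⟨dblExp μ β x l - k, ?_⟩ fun M hM => ?_
      · change IsDbl μ β x _
        rw [← mul_assoc, ← pow_add, Nat.sub_add_cancel hk]
        exact hN
      · change IsDbl μ β x _ at hM
        rw [← mul_assoc, ← pow_add] at hM
        have : dblExp μ β x l ≤ M + k := Nat.sInf_le hM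
        omega
  rw [dblSide, dblSide, hexp, ← mul_assoc, ← pow_add, Nat.sub_add_cancel hk]

/-- The bound for `K_{Q,R}`, where `R` is the smallest doubling cube among `P, 2P, …` and the cube
`P` is comparable to `Q`. Below `R` the cubes `2^j P` are not doubling, so the terms of the sum
decay geometrically as one goes down from `R`. -/
lemma HasGrowth.sum_le (h : HasGrowth μ n C) (hC : 0 ≤ C) (hβ : 2 ^ n < β)
    (hl : 0 < l) (m : ℕ) (hxz : ∀ i, |x i - z i| ≤ 2 ^ m * l / 2) :
    ∑ k ∈ Finset.Icc 1 (dblExp μ β z (2 ^ m * l) + m), μ.real (cube x (2 ^ k * l)) / (2 ^ k * l) ^ n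
      ≤ m * C + C * β / (1 - 2 ^ n / β) := by
  have hβ0 : 0 < β := lt_trans (by positivity) hβ
  set N := dblExp μ β z (2 ^ m * l) with hN
  set q := 2 ^ n / β with hq
  have hq0 : 0 < q := by positivity
  have hq1 : q < 1 := (div_lt_one hβ0).2 hβ
  set t : ℕ → ℝ := fun k => μ.real (cube x (2 ^ k * l)) / (2 ^ k * l) ^ n with ht
  have hbase : ∀ k, t k ≤ C := fun k =>
    div_le_of_le_mul₀ (by positivity) hC (h.real_le hC x (by positivity))
  set a : ℕ → ℝ := fun j => μ.real (cube z (2 ^ j * (2 ^ m * l))) with ha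
  have hstep : ∀ j < N, β * a j ≤ a (j + 1) := by
    intro j hj
    have h1 : ¬ IsDbl μ β z (2 ^ j * (2 ^ m * l)) := Nat.notMem_of_lt_sInf hj
    rw [h.isDbl_iff hβ0.le, not_le, ← mul_assoc 2, ← pow_succ'] at h1
    exact h1.le
  have hterm : ∀ i < N, t (N - i + m) ≤ C * β * q ^ i := by
    intro i hi
    rcases Nat.eq_zero_or_pos i with rfl | hi0
    · have hβ1 : 1 ≤ β := (one_le_pow₀ one_le_two).trans hβ.le
      rw [pow_zero, mul_one]
      exact (hbase _).trans (le_mul_of_one_le_right hC hβ1)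
    · obtain ⟨i, rfl⟩ := Nat.exists_eq_add_of_le' hi0
      obtain ⟨M, hM⟩ : ∃ M, N = M + (i + 1) := ⟨N - (i + 1), by omega⟩
      have hsub : cube x (2 ^ (M + m) * l) ⊆ cube z (2 ^ (M + 1) * (2 ^ m * l)) := by
        refine cube_subset fun j => (hxz j).trans ?_
        have : (1 : ℝ) ≤ 2 ^ M := one_le_pow₀ one_le_two
        have h2 : 0 < 2 ^ m * l := by positivity
        rw [pow_add, pow_add]
        nlinarith
      have h1 : μ.real (cube x (2 ^ (M + m) * l)) ≤ a (M + 1) :=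
        measureReal_mono hsub (h.measure_cube_lt_top _ _).ne
      have h2 := pow_mul_le_of_step hβ0.le hstep i (by omega)
      rw [show N - i = M + 1 by omega] at h2
      have h3 : a N ≤ C * (2 ^ N * (2 ^ m * l)) ^ n := h.real_le hC z (by positivity)
      have h4 : (2 ^ N * (2 ^ m * l)) ^ n = (2 ^ (M + m) * l) ^ n * (2 ^ n) ^ (i + 1) := by
        rw [← pow_mul, mul_comm n, pow_mul, ← mul_pow, hM]
        ring
      rw [show N - (i + 1) + m = M + m by omega]
      refine div_le_of_le_mul₀ (by positivity) (by positivity) ?_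
      have h5 : C * β * q ^ (i + 1) * (2 ^ (M + m) * l) ^ n * β ^ i
          = C * ((2 ^ (M + m) * l) ^ n * (2 ^ n) ^ (i + 1)) := by
        rw [hq, div_pow]
        field_simp
        ring
      have h6 : μ.real (cube x (2 ^ (M + m) * l)) * β ^ i
          ≤ C * β * q ^ (i + 1) * (2 ^ (M + m) * l) ^ n * β ^ i := by
        rw [h5, ← h4]
        calc _ ≤ a (M + 1) * β ^ i := mul_le_mul_of_nonneg_right h1 (by positivity)
          _ ≤ _ := by linarith
      exact le_of_mul_le_mul_right h6 (by positivity)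
  have hsplit : ∑ k ∈ Finset.Icc 1 (N + m), t k
      = ∑ k ∈ Finset.range m, t (k + 1) + ∑ i ∈ Finset.range N, t (N - i + m) := by
    have h1 : ∑ k ∈ Finset.Icc 1 (N + m), t k = ∑ k ∈ Finset.range (m + N), t (k + 1) := by
      rw [Finset.range_eq_Ico, Finset.sum_Ico_add' t 0 _ 1, add_comm m N]
      rfl
    rw [h1, Finset.sum_range_add, ← Finset.sum_range_reflect (fun j => t (m + j + 1))]
    congr 1
    refine Finset.sum_congr rfl fun i hi => ?_
    rw [Finset.mem_range] at hi
    congr 1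
    omega
  rw [hsplit]
  refine add_le_add ?_ ?_
  · calc ∑ k ∈ Finset.range m, t (k + 1) ≤ ∑ _k ∈ Finset.range m, C :=
          Finset.sum_le_sum fun k _ => hbase _
      _ = m * C := by simp
  · calc ∑ i ∈ Finset.range N, t (N - i + m) ≤ ∑ i ∈ Finset.range N, C * β * q ^ i :=
          Finset.sum_le_sum fun i hi => hterm i (Finset.mem_range.1 hi)
      _ = C * β * ∑ i ∈ Finset.range N, q ^ i := by rw [Finset.mul_sum]
      _ ≤ C * β * (1 - q)⁻¹ := by
          refine mul_le_mul_of_nonneg_left ?_ (by positivity)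
          rw [← tsum_geometric_of_lt_one hq0.le hq1]
          exact (summable_geometric_of_lt_one hq0.le hq1).sum_le_tsum _ fun i _ => by positivity
      _ = C * β / (1 - q) := by rw [div_eq_mul_inv]

end

/-! ### What is used of the space `RBMO` -/

/-- The consequences of `f ∈ RBMO(μ)` on which the argument rests, expressed through cubes with a
center in the support of `μ`. The first is the oscillation condition. The second compares the mean
over a doubling cube `Q` with the mean over the smallest doubling cube among `P, 2P, 4P, …`, where
`P ⊇ Q` has side length `2^m l(Q)`. -/
structure HasOsc {𝕜 : Type*} [RCLike 𝕜] (μ : Measure (EuclideanSpace ℝ (Fin d))) (β : ℝ)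
    (f : EuclideanSpace ℝ (Fin d) → 𝕜) (K c : ℝ) : Prop where
  osc : ∀ x ∈ μ.support, ∀ l, 0 < l →
    ∫⁻ y in cube x l, ‖f y - ⨍ w in cube x (dblSide μ β x l), f w ∂μ‖ₑ ∂μ
      ≤ ENNReal.ofReal K * μ (cube x (2 * l))
  comp : ∀ x ∈ μ.support, ∀ z ∈ μ.support, ∀ l, 0 < l → ∀ m : ℕ, IsDbl μ β x l →
    (∀ i, |x i - z i| ≤ (2 ^ m - 1) * l / 2) →
    ‖(⨍ y in cube x l, f y ∂μ) - ⨍ y in cube z (dblSide μ β z (2 ^ m * l)), f y ∂μ‖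
      ≤ K * (c * (m + 1))

section

variable {𝕜 : Type*} [RCLike 𝕜] {μ : Measure (EuclideanSpace ℝ (Fin d))} {n : ℕ} {C β l K : ℝ}
  {x z : EuclideanSpace ℝ (Fin d)} {f : EuclideanSpace ℝ (Fin d) → 𝕜}

lemma isDoubling_box (hx : x ∈ μ.support) (hl : 0 < l) :
    (Cube.box x hx l hl).IsDoubling β ↔ IsDbl μ β x l := by
  simp [Cube.IsDoubling, Cube.dilate, Cube.toSet, IsDbl, cube]

lemma tilde_box (hx : x ∈ μ.support) (hl : 0 < l) :
    (Cube.box x hx l hl).tilde β = Cube.box x hx (dblSide μ β x l) (dblSide_pos hl) := by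
  simp only [Cube.tilde, Cube.dilate, isDoubling_box]
  rfl

lemma toSet_box (hx : x ∈ μ.support) (hl : 0 < l) : (Cube.box x hx l hl).toSet = cube x l := rfl

lemma coeffK_box (hx : x ∈ μ.support) (hz : z ∈ μ.support) (hl : 0 < l) (m : ℕ) :
    (Cube.box x hx l hl).coeffK n
      (Cube.box z hz (dblSide μ β z (2 ^ m * l)) (dblSide_pos (by positivity))) =
    1 + ∑ k ∈ Finset.Icc 1 (dblExp μ β z (2 ^ m * l) + m),
      μ.real (cube x (2 ^ k * l)) / (2 ^ k * l) ^ n := by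
  have : sInf {k : ℕ | dblSide μ β z (2 ^ m * l) ≤ 2 ^ k * l} = dblExp μ β z (2 ^ m * l) + m := by
    have h1 : {k : ℕ | dblSide μ β z (2 ^ m * l) ≤ 2 ^ k * l}
        = Ici (dblExp μ β z (2 ^ m * l) + m) := by
      ext k
      simp only [mem_ofPred_eq, mem_Ici, dblSide]
      rw [← mul_assoc, ← pow_add, mul_le_mul_iff_left₀ hl, pow_le_pow_iff_right₀ one_lt_two]
    rw [h1, csInf_Ici]
  simp only [Cube.coeffK, this]
  rfl

/-- The constant in the comparison of means. -/
noncomputable def compConst (n : ℕ) (β C : ℝ) : ℝ := 1 + C + C * β / (1 - 2 ^ n / β)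

lemma one_le_compConst (hC : 0 ≤ C) (hβ : 2 ^ n < β) : 1 ≤ compConst n β C := by
  have hβ0 : 0 < β := lt_trans (by positivity) hβ
  have : 0 < 1 - 2 ^ n / β := sub_pos.2 ((div_lt_one hβ0).2 hβ)
  have : 0 ≤ C * β / (1 - 2 ^ n / β) := by positivity
  rw [compConst]
  linarith

lemma HasGrowth.hasOsc (h : HasGrowth μ n C) (hC : 0 ≤ C) (hβ : 2 ^ n < β) (hK : 0 ≤ K)
    (hf : RBMOWith μ n β f K) : HasOsc μ β f K (compConst n β C) where
  osc x hx l hl := by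
    have := hf.2.1 (Cube.box x hx l hl)
    simpa [tilde_box, toSet_box, Cube.dilate] using this
  comp x hx z hz l hl m hdbl hxz := by
    have hL : 0 < 2 ^ m * l := by positivity
    have hsub : cube x l ⊆ cube z (dblSide μ β z (2 ^ m * l)) :=
      (cube_subset fun i => (hxz i).trans_eq (by ring)).trans (cube_mono z (le_dblSide hL))
    have h1 := hf.2.2 (Cube.box x hx l hl)
      (Cube.box z hz (dblSide μ β z (2 ^ m * l)) (dblSide_pos hL))
      ((isDoubling_box _ _).2 hdbl) ((isDoubling_box _ _).2 (h.isDbl_dblSide hC hβ hz hL)) hsub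
    rw [coeffK_box] at h1
    refine h1.trans (mul_le_mul_of_nonneg_left ?_ hK)
    have h2 := h.sum_le (β := β) hC hβ hl m fun i => (hxz i).trans (by nlinarith)
    have hβ0 : 0 < β := lt_trans (by positivity) hβ
    have h3 : 0 < 1 - 2 ^ n / β := sub_pos.2 ((div_lt_one hβ0).2 hβ)
    have h4 : 0 ≤ C * β / (1 - 2 ^ n / β) := by positivity
    have h5 : (0 : ℝ) ≤ m := m.cast_nonneg
    rw [compConst]
    nlinarith [mul_nonneg h5 h4]

lemma rbmoWith_mono {K' : ℝ} (hf : RBMOWith μ n β f K) (hK : K ≤ K') : RBMOWith μ n β f K' := by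
  refine ⟨hf.1, fun Q => (hf.2.1 Q).trans ?_, fun Q R hQ hR hQR => (hf.2.2 Q R hQ hR hQR).trans ?_⟩
  · gcongr
  · refine mul_le_mul_of_nonneg_right hK ?_
    cases Q <;> cases R <;> simp only [Cube.coeffK]
    · rename_i hl _ _ _ _; positivity
    · rename_i hl _; positivity
    · exact zero_le_one
    · exact zero_le_one

lemma rbmoWith_of_rbmoNorm_lt (hf : MemRBMO μ n β f) (hK : rbmoNorm μ n β f < K) :
    0 ≤ K ∧ RBMOWith μ n β f K := by
  obtain ⟨K', ⟨h0, h1⟩, h2⟩ := exists_lt_of_csInf_lt hf hK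
  exact ⟨h0.trans h2.le, rbmoWith_mono h1 h2.le⟩

end

/-! ### The maximal function over centered doubling cubes -/

/-- The level set `{N f > t}` of the maximal function `N f (x) = sup |m_Q f|`, where `Q` runs over
the doubling cubes with center `x`, on the support of `μ`. -/
def levelSet {𝕜 : Type*} [RCLike 𝕜] (μ : Measure (EuclideanSpace ℝ (Fin d))) (β : ℝ)
    (f : EuclideanSpace ℝ (Fin d) → 𝕜) (t : ℝ) : Set (EuclideanSpace ℝ (Fin d)) :=
  {x | x ∈ μ.support ∧ ∃ l, 0 < l ∧ IsDbl μ β x l ∧ t < ‖⨍ y in cube x l, f y ∂μ‖}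

lemma enorm_average_rpow_mul_le {α 𝕜 : Type*} [RCLike 𝕜] [MeasurableSpace α] (ν : Measure α)
    [IsFiniteMeasure ν] {f : α → 𝕜} (hf : AEStronglyMeasurable f ν) {q : ℝ} (hq : 1 ≤ q) :
    ‖⨍ x, f x ∂ν‖ₑ ^ q * ν univ ≤ ∫⁻ x, ‖f x‖ₑ ^ q ∂ν := by
  have hq0 : 0 < q := zero_lt_one.trans_le hq
  rcases eq_or_ne ν 0 with rfl | hν
  · simp
  have : NeZero ν := ⟨hν⟩
  have hP : IsProbabilityMeasure ((ν univ)⁻¹ • ν) := isProbabilityMeasureSMul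
  have h1 : ‖⨍ x, f x ∂ν‖ₑ ≤ eLpNorm f (ENNReal.ofReal q) ((ν univ)⁻¹ • ν) :=
    (enorm_integral_le_lintegral_enorm _).trans <|
      (eLpNorm_one_eq_lintegral_enorm (f := f) (μ := (ν univ)⁻¹ • ν)).symm.trans_le <|
        eLpNorm_le_eLpNorm_of_exponent_le (by simpa using ENNReal.ofReal_le_ofReal hq)
          (hf.smul_measure _)
  have h2 : eLpNorm f (ENNReal.ofReal q) ((ν univ)⁻¹ • ν) ^ q
      = (ν univ)⁻¹ * ∫⁻ x, ‖f x‖ₑ ^ q ∂ν := by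
    rw [eLpNorm_eq_lintegral_rpow_enorm_toReal (by simpa using hq0) ENNReal.ofReal_ne_top,
      ENNReal.toReal_ofReal hq0.le, ← ENNReal.rpow_mul, one_div, inv_mul_cancel₀ hq0.ne',
      ENNReal.rpow_one, lintegral_smul_measure, smul_eq_mul]
  calc ‖⨍ x, f x ∂ν‖ₑ ^ q * ν univ ≤ ((ν univ)⁻¹ * ∫⁻ x, ‖f x‖ₑ ^ q ∂ν) * ν univ := by
        rw [← h2]; gcongr
    _ = ∫⁻ x, ‖f x‖ₑ ^ q ∂ν := by
        rw [mul_right_comm, ENNReal.inv_mul_cancel (by simpa using hν) (measure_ne_top _ _),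
          one_mul]

section

variable {𝕜 : Type*} [RCLike 𝕜] {μ : Measure (EuclideanSpace ℝ (Fin d))} {n : ℕ} {C β l K : ℝ}
  {x z : EuclideanSpace ℝ (Fin d)} {f : EuclideanSpace ℝ (Fin d) → 𝕜}

lemma HasGrowth.enorm_average_rpow_mul_le (h : HasGrowth μ n C) (hf : AEStronglyMeasurable f μ)
    {q : ℝ} (hq : 1 ≤ q) (x : EuclideanSpace ℝ (Fin d)) (l : ℝ) :
    ‖⨍ y in cube x l, f y ∂μ‖ₑ ^ q * μ (cube x l) ≤ ∫⁻ y in cube x l, ‖f y‖ₑ ^ q ∂μ := by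
  have : IsFiniteMeasure (μ.restrict (cube x l)) :=
    ⟨by simpa using h.measure_cube_lt_top x l⟩
  simpa using RBMO.enorm_average_rpow_mul_le (μ.restrict (cube x l)) hf.restrict hq

lemma levelSet_mono {s t : ℝ} (hst : s ≤ t) : levelSet μ β f t ⊆ levelSet μ β f s :=
  fun _ ⟨hx, l, hl, hd, ht⟩ => ⟨hx, l, hl, hd, hst.trans_lt ht⟩

lemma integrableOn_cube (hf : LocallyIntegrable f μ)
    (x : EuclideanSpace ℝ (Fin d)) (l : ℝ) : IntegrableOn f (cube x l) μ := by
  refine hf.integrableOn_isCompact ?_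
  refine Metric.isCompact_of_isClosed_isBounded (isClosed_cube x l) ?_
  have h1 : cube x l ⊆ cube x (max l 0) := cube_mono x (le_max_left _ _)
  rw [cube_eq_preimage x (le_max_right l 0)] at h1
  exact ((PiLp.antilipschitzWith_ofLp 2 _).isBounded_preimage isBounded_closedBall).subset h1

lemma levelSet_add_subset {g : EuclideanSpace ℝ (Fin d) → 𝕜}
    (hf : LocallyIntegrable f μ) (hg : LocallyIntegrable g μ) (s t : ℝ) :
    levelSet μ β (f + g) (s + t) ⊆ levelSet μ β f s ∪ levelSet μ β g t := by
  rintro x ⟨hx, l, hl, hd, ht⟩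
  have h1 : ⨍ y in cube x l, (f + g) y ∂μ
      = (⨍ y in cube x l, f y ∂μ) + ⨍ y in cube x l, g y ∂μ := by
    simp only [Pi.add_apply, setAverage_eq]
    rw [integral_add (integrableOn_cube hf x l) (integrableOn_cube hg x l), smul_add]
  rw [h1] at ht
  have h2 := norm_add_le (⨍ y in cube x l, f y ∂μ) (⨍ y in cube x l, g y ∂μ)
  by_cases h3 : s < ‖⨍ y in cube x l, f y ∂μ‖
  · exact Or.inl ⟨hx, l, hl, hd, h3⟩
  · exact Or.inr ⟨hx, l, hl, hd, by linarith⟩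

lemma levelSet_congr {g : EuclideanSpace ℝ (Fin d) → 𝕜} (hfg : f =ᵐ[μ] g) (t : ℝ) :
    levelSet μ β f t = levelSet μ β g t := by
  have h1 : ∀ x l, ⨍ y in cube x l, f y ∂μ = ⨍ y in cube x l, g y ∂μ := fun x l => by
    rw [setAverage_eq, setAverage_eq, integral_congr_ae (ae_restrict_of_ae hfg)]
  simp only [levelSet, h1]

/-- The weak type `(q, q)` inequality for the maximal function over centered doubling cubes. -/
lemma HasGrowth.measure_levelSet_le (h : HasGrowth μ n C) {B : ℝ}
    (hB : IsCoveringConst d B)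
    (hf : AEStronglyMeasurable f μ) {q : ℝ} (hq : 1 ≤ q) {t : ℝ} (ht : 0 < t) :
    μ (levelSet μ β f t)
      ≤ ENNReal.ofReal B * ((ENNReal.ofReal t ^ q)⁻¹ * ∫⁻ y, ‖f y‖ₑ ^ q ∂μ) := by
  have hq0 : 0 < q := zero_lt_one.trans_le hq
  have ht0 : ENNReal.ofReal t ^ q ≠ 0 := by simp [ht]
  have ht1 : ENNReal.ofReal t ^ q ≠ ∞ := by simp [hq0.le]
  have h1 := hB μ ((ENNReal.ofReal t ^ q)⁻¹ • μ.withDensity fun y => ‖f y‖ₑ ^ q)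
    (levelSet μ β f t) univ ?_
  · simpa using h1
  · rintro x ⟨-, l, hl, -, hlt⟩
    refine ⟨l, hl, subset_univ _, (measure_mono inter_subset_right).trans ?_⟩
    rw [Measure.smul_apply, smul_eq_mul, withDensity_apply _ (measurableSet_cube x l),
      ← ENNReal.mul_le_iff_le_inv ht0 ht1]
    refine le_trans ?_ (h.enorm_average_rpow_mul_le hf hq x l)
    gcongr
    rw [← ofReal_norm]
    exact ENNReal.ofReal_le_ofReal hlt.le

lemma map_closedBall (μ : Measure (EuclideanSpace ℝ (Fin d))) (x : EuclideanSpace ℝ (Fin d))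
    {r : ℝ} (hr : 0 ≤ r) :
    μ.map (MeasurableEquiv.toLp 2 (Fin d → ℝ)).symm (closedBall (WithLp.ofLp x) r)
      = μ (cube x (2 * r)) := by
  rw [MeasurableEquiv.map_apply, cube_eq_preimage x (by positivity),
    mul_div_cancel_left₀ _ two_ne_zero]
  rfl

lemma HasGrowth.isLocallyFiniteMeasure_map (h : HasGrowth μ n C) :
    IsLocallyFiniteMeasure (μ.map (MeasurableEquiv.toLp 2 (Fin d → ℝ)).symm) := by
  refine ⟨fun x => ⟨closedBall x 1, closedBall_mem_nhds x one_pos, ?_⟩⟩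
  have := map_closedBall μ (WithLp.toLp 2 x) zero_le_one
  rw [WithLp.ofLp_toLp] at this
  rw [this]
  exact h.measure_cube_lt_top _ _

/-- Almost every point is the center of arbitrarily small doubling cubes. If the cubes with center
`x` and side length `2^{-k} l` are not doubling, then their measure decays at least like `β^{-k}`,
whereas their volume decays like `2^{-kd}`; as `β > 2^d`, the density at `x` of the Lebesgue measure
with respect to `μ` is then infinite. -/
lemma HasGrowth.ae_frequently_isDbl (h : HasGrowth μ n C) (hβ : 2 ^ d < β) :
    ∀ᵐ x ∂μ, ∀ ε > 0, ∃ l, 0 < l ∧ l < ε ∧ IsDbl μ β x l := by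
  have hβ0 : 0 < β := lt_trans (by positivity) hβ
  have := h.isLocallyFiniteMeasure_map
  have hE := h.isLocallyFiniteMeasure
  set e := (MeasurableEquiv.toLp 2 (Fin d → ℝ)).symm with he
  have h1 := ae_of_ae_map e.measurable.aemeasurable
    (Besicovitch.ae_tendsto_rnDeriv (volume : Measure (Fin d → ℝ)) (μ.map e))
  have h2 := ae_of_ae_map e.measurable.aemeasurable
    (Measure.rnDeriv_lt_top (volume : Measure (Fin d → ℝ)) (μ.map e))
  filter_upwards [h1, h2, Measure.support_mem_ae] with x hx1 hx2 hx ε hε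
  by_contra! hcon
  set a : ℕ → ℝ := fun k => μ.real (cube x (2 * (ε / 4 * (1 / 2) ^ k))) with ha
  have hstep : ∀ k, β ^ k * a k ≤ a 0 := by
    intro k
    induction k with
    | zero => simp
    | succ k ih =>
      have hk1 : (1 / 2 : ℝ) ^ (k + 1) ≤ 1 := pow_le_one₀ (by norm_num) (by norm_num)
      have h3 := hcon (2 * (ε / 4 * (1 / 2) ^ (k + 1))) (by positivity) (by nlinarith)
      rw [h.isDbl_iff hβ0.le, not_le] at h3
      have h4 : 2 * (2 * (ε / 4 * (1 / 2) ^ (k + 1))) = 2 * (ε / 4 * (1 / 2) ^ k) := by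
        rw [pow_succ]; ring
      rw [h4] at h3
      calc β ^ (k + 1) * a (k + 1) = β ^ k * (β * a (k + 1)) := by ring
        _ ≤ β ^ k * a k := mul_le_mul_of_nonneg_left h3.le (by positivity)
        _ ≤ a 0 := ih
  have hlim : Tendsto (fun k : ℕ => ε / 4 * (1 / 2 : ℝ) ^ k) atTop (𝓝[>] 0) := by
    refine tendsto_nhdsWithin_iff.2 ⟨?_, Eventually.of_forall fun k => ?_⟩
    · simpa using (tendsto_pow_atTop_nhds_zero_of_lt_one (r := (1 / 2 : ℝ)) (by norm_num)
        (by norm_num)).const_mul (ε / 4)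
    · simp only [mem_Ioi]; positivity
  obtain ⟨M, hM, -⟩ := ENNReal.lt_iff_exists_nnreal_btwn.1 hx2
  have h5 := (hx1.comp hlim).eventually_lt_const hM
  have h6 : ∀ᶠ k : ℕ in atTop, (M * a 0) / (2 * (ε / 4)) ^ d < (β / 2 ^ d) ^ k :=
    (tendsto_pow_atTop_atTop_of_one_lt
      ((one_lt_div (by positivity)).2 hβ)).eventually_gt_atTop _
  obtain ⟨k, hk5, hk6⟩ := (h5.and h6).exists
  have hr : 0 < ε / 4 * (1 / 2 : ℝ) ^ k := by positivity
  simp only [Function.comp_apply] at hk5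
  have hxe : e x = WithLp.ofLp x := rfl
  rw [hxe, map_closedBall μ x hr.le, Real.volume_pi_closedBall _ hr.le, Fintype.card_fin,
    ENNReal.div_lt_iff (Or.inl (measure_cube_pos hx (by positivity)).ne')
      (Or.inl (h.measure_cube_lt_top _ _).ne)] at hk5
  have h7 : (2 * (ε / 4 * (1 / 2 : ℝ) ^ k)) ^ d ≤ M * a k := by
    have := ENNReal.toReal_mono (ENNReal.mul_ne_top ENNReal.coe_ne_top
      (h.measure_cube_lt_top _ _).ne) hk5.le
    rwa [ENNReal.toReal_ofReal (by positivity), ENNReal.toReal_mul] at this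
  have h8 := hstep k
  have h9 : (2 * (ε / 4 * (1 / 2 : ℝ) ^ k)) ^ d * (2 ^ d) ^ k = (2 * (ε / 4)) ^ d := by
    rw [← pow_mul, mul_comm d k, pow_mul, ← mul_pow]
    congr 1
    rw [mul_assoc, mul_assoc, ← mul_pow]
    norm_num
  rw [div_lt_iff₀ (by positivity), div_pow, div_mul_eq_mul_div, lt_div_iff₀ (by positivity)] at hk6
  have hM0 : (0 : ℝ) ≤ M := M.2
  rw [← h9, ← mul_assoc] at hk6
  have h10 := lt_of_mul_lt_mul_right hk6 (by positivity)
  nlinarith [pow_pos hβ0 k, mul_le_mul_of_nonneg_left h7 (pow_pos hβ0 k).le]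

/-- The maximal function dominates `|f|` almost everywhere, by Lebesgue differentiation along the
small doubling cubes. -/
lemma HasGrowth.ae_mem_levelSet (h : HasGrowth μ n C) (hβ : 2 ^ d < β)
    (hf : LocallyIntegrable f μ) : ∀ᵐ x ∂μ, ∀ t, t < ‖f x‖ → x ∈ levelSet μ β f t := by
  have := h.isLocallyFiniteMeasure_map
  have hE := h.isLocallyFiniteMeasure
  set e := (MeasurableEquiv.toLp 2 (Fin d → ℝ)).symm with he
  have hball : ∀ (x : EuclideanSpace ℝ (Fin d)) {r : ℝ}, 0 ≤ r →
      e ⁻¹' closedBall (e x) r = cube x (2 * r) := by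
    intro x r hr
    rw [cube_eq_preimage x (by positivity), mul_div_cancel_left₀ _ two_ne_zero]
    rfl
  have hloc : LocallyIntegrable (f ∘ e.symm) (μ.map e) := by
    intro x
    refine ⟨closedBall x 1, closedBall_mem_nhds x one_pos, ?_⟩
    rw [integrableOn_map_equiv]
    have h1 := hball (e.symm x) zero_le_one
    rw [e.apply_symm_apply] at h1
    rw [h1]
    have h2 : (f ∘ e.symm) ∘ e = f := by ext y; simp
    rw [h2]
    exact integrableOn_cube hf _ _
  have h1 := ae_of_ae_map e.measurable.aemeasurable
    ((Besicovitch.vitaliFamily (μ.map e)).ae_tendsto_average hloc)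
  filter_upwards [h1, h.ae_frequently_isDbl hβ, Measure.support_mem_ae] with x hx1 hx2 hx t ht
  have h3 := hx1.comp (Besicovitch.tendsto_filterAt (μ.map e) (e x))
  simp only [Function.comp_apply, e.symm_apply_apply] at h3
  have h4 := h3.norm.eventually_const_lt ht
  rw [Filter.Eventually, mem_nhdsGT_iff_exists_Ioo_subset] at h4
  obtain ⟨u, hu, hsub⟩ := h4
  obtain ⟨l, hl, hlu, hd⟩ := hx2 u hu
  refine ⟨hx, l, hl, hd, ?_⟩
  have h5 : l / 2 ∈ Ioo 0 u := ⟨by positivity, by linarith⟩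
  have h6 := hsub h5
  simp only [mem_ofPred_eq, Function.comp_apply] at h6
  rw [setAverage_eq, setIntegral_map_equiv, measureReal_def, MeasurableEquiv.map_apply,
    hball x h5.1.le, mul_div_cancel₀ _ two_ne_zero] at h6
  simpa [setAverage_eq, measureReal_def] using h6

end

/-! ### The good-`λ` inequality for functions of bounded oscillation -/

section

variable {𝕜 : Type*} [RCLike 𝕜] {μ : Measure (EuclideanSpace ℝ (Fin d))} {n : ℕ} {B C β l L K c : ℝ}
  {x z : EuclideanSpace ℝ (Fin d)} {f : EuclideanSpace ℝ (Fin d) → 𝕜}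

/-- The integral over `(3/2) S` is controlled by the integrals over cubes of side length `l(S) / 4`
with centers in the support of `μ`. The points of `(3/2) S` are sorted by the integer parts of
their coordinates relative to `S`, in units of `l(S) / 8`; these take the `13` values `-6, …, 6`,
and points of the same class lie in a common cube of side length `l(S) / 4`. -/
lemma setLIntegral_cube_le (hL : 0 < L) {F : EuclideanSpace ℝ (Fin d) → ℝ≥0∞} {b : ℝ≥0∞}
    (hF : ∀ z ∈ μ.support, z ∈ cube x (3 / 2 * L) → ∫⁻ y in cube z (L / 4), F y ∂μ ≤ b) :
    ∫⁻ y in cube x (3 / 2 * L), F y ∂μ ≤ 13 ^ d * b := by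
  let cell : (Fin d → Finset.Icc (-6 : ℤ) 6) → Set (EuclideanSpace ℝ (Fin d)) := fun k =>
    {y | y ∈ μ.support ∧ y ∈ cube x (3 / 2 * L) ∧ ∀ i, ⌊8 * (y i - x i) / L⌋ = k i}
  have hcov : (cube x (3 / 2 * L) : Set _) ≤ᵐ[μ] ⋃ k, cell k := by
    filter_upwards [Measure.support_mem_ae (μ := μ)] with y hy hyx
    refine mem_iUnion.2 ⟨fun i => ⟨⌊8 * (y i - x i) / L⌋, ?_⟩, hy, hyx, fun i => rfl⟩
    have h1 := abs_le.1 (hyx i)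
    rw [Finset.mem_Icc]
    constructor
    · rw [Int.le_floor, le_div_iff₀ hL]; push_cast; linarith
    · rw [← Int.lt_add_one_iff, Int.floor_lt, div_lt_iff₀ hL]; push_cast; linarith
  calc ∫⁻ y in cube x (3 / 2 * L), F y ∂μ ≤ ∫⁻ y in ⋃ k, cell k, F y ∂μ :=
        lintegral_mono' (Measure.restrict_mono_ae hcov) le_rfl
    _ ≤ ∑' k, ∫⁻ y in cell k, F y ∂μ := lintegral_iUnion_le _ _
    _ ≤ ∑' _k : Fin d → Finset.Icc (-6 : ℤ) 6, b := by
        refine ENNReal.tsum_le_tsum fun k => ?_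
        rcases (cell k).eq_empty_or_nonempty with hk | ⟨z, hzs, hzx, hzk⟩
        · simp [hk]
        · refine (lintegral_mono_set fun y hy i => ?_).trans (hF z hzs hzx)
          have h1 : |8 * (y i - x i) / L - 8 * (z i - x i) / L| < 1 :=
            Int.abs_sub_lt_one_of_floor_eq_floor ((hy.2.2 i).trans (hzk i).symm)
          have h2 : 8 * (y i - x i) / L - 8 * (z i - x i) / L = 8 / L * (y i - z i) := by ring
          rw [h2, abs_mul, abs_of_pos (by positivity), div_mul_eq_mul_div, div_lt_one hL] at h1
          linarith
    _ = 13 ^ d * b := by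
        rw [tsum_fintype]
        simp

/-- The mean over a doubling cube `S` differs by at most `8cK` from the mean over the smallest
doubling cube among `Q, 2Q, …`, if `Q` has side length `l(S)/4` and its center lies in `(3/2) S`:
both are compared with the smallest doubling cube among `P, 2P, …`, where `P = 16 Q ⊇ S`. -/
lemma HasOsc.norm_average_sub_le (h : HasOsc μ β f K c) (hG : HasGrowth μ n C) (hC : 0 ≤ C)
    (hβ : 2 ^ n < β) (hK : 0 ≤ K) (hc : 1 ≤ c) (hL : 0 < L) (hx : x ∈ μ.support)
    (hz : z ∈ μ.support) (hxL : IsDbl μ β x L) (hzx : z ∈ cube x (3 / 2 * L)) :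
    ‖(⨍ y in cube z (dblSide μ β z (L / 4)), f y ∂μ) - ⨍ y in cube x L, f y ∂μ‖
      ≤ 8 * c * K := by
  have h1 := h.comp x hx z hz L hL 2 hxL fun i => by
    rw [abs_sub_comm]; exact (hzx i).trans (by linarith)
  have h2 : ‖(⨍ y in cube z (dblSide μ β z (L / 4)), f y ∂μ)
      - ⨍ y in cube z (dblSide μ β z (2 ^ 2 * L)), f y ∂μ‖ ≤ K * (c * 5) := by
    rcases le_or_gt 4 (dblExp μ β z (L / 4)) with hN | hN
    · have h3 := dblSide_two_pow_mul hN
      rw [show (2 : ℝ) ^ 4 * (L / 4) = 2 ^ 2 * L by ring] at h3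
      rw [h3, sub_self, norm_zero]
      positivity
    · have h3 := h.comp z hz z hz (dblSide μ β z (L / 4)) (dblSide_pos (by positivity))
        (4 - dblExp μ β z (L / 4)) (hG.isDbl_dblSide hC hβ hz (by positivity)) fun i => by
          have h5 : (1 : ℝ) ≤ 2 ^ (4 - dblExp μ β z (L / 4)) := one_le_pow₀ one_le_two
          have h6 : 0 < dblSide μ β z (L / 4) := dblSide_pos (by positivity)
          simp only [sub_self, abs_zero]
          have := mul_nonneg (sub_nonneg.2 h5) h6.le
          linarith
      have h4 : 2 ^ (4 - dblExp μ β z (L / 4)) * dblSide μ β z (L / 4) = 2 ^ 2 * L := by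
        rw [dblSide, ← mul_assoc, ← pow_add, Nat.sub_add_cancel hN.le]
        ring
      rw [h4] at h3
      refine h3.trans ?_
      gcongr
      have : ((4 - dblExp μ β z (L / 4) : ℕ) : ℝ) ≤ 4 := by exact_mod_cast Nat.sub_le _ _
      linarith
  have h3 := norm_sub_le_norm_sub_add_norm_sub (⨍ y in cube z (dblSide μ β z (L / 4)), f y ∂μ)
    (⨍ y in cube z (dblSide μ β z (2 ^ 2 * L)), f y ∂μ) (⨍ y in cube x L, f y ∂μ)
  rw [norm_sub_rev (⨍ y in cube z (dblSide μ β z (2 ^ 2 * L)), f y ∂μ)] at h3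
  push_cast at h1
  calc _ ≤ _ := h3
    _ ≤ K * (c * 5) + K * (c * (2 + 1)) := add_le_add h2 h1
    _ = 8 * c * K := by ring

/-- The oscillation of `f` on `(3/2) S`, for a doubling cube `S`. The point is that only `μ(S)`
appears on the right, although the oscillation condition on `(3/2) S` itself involves `μ(3S)`. -/
lemma HasOsc.setLIntegral_le (h : HasOsc μ β f K c) (hG : HasGrowth μ n C) (hC : 0 ≤ C)
    (hβ : 2 ^ n < β) (hK : 0 ≤ K) (hc : 1 ≤ c) (hL : 0 < L) (hx : x ∈ μ.support)
    (hxL : IsDbl μ β x L) :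
    ∫⁻ y in cube x (3 / 2 * L), ‖f y - ⨍ w in cube x L, f w ∂μ‖ₑ ∂μ
      ≤ ENNReal.ofReal (13 ^ d * (9 * c * β) * K) * μ (cube x L) := by
  have hβ0 : 0 < β := lt_trans (by positivity) hβ
  have key : ∀ z ∈ μ.support, z ∈ cube x (3 / 2 * L) →
      ∫⁻ y in cube z (L / 4), ‖f y - ⨍ w in cube x L, f w ∂μ‖ₑ ∂μ
        ≤ ENNReal.ofReal (9 * c * K) * (ENNReal.ofReal β * μ (cube x L)) := by
    intro z hz hzx
    have h1 := h.norm_average_sub_le hG hC hβ hK hc hL hx hz hxL hzx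
    set mz := ⨍ y in cube z (dblSide μ β z (L / 4)), f y ∂μ
    set mS := ⨍ y in cube x L, f y ∂μ
    have h2 : cube z (2 * (L / 4)) ⊆ cube x (2 * L) :=
      cube_subset fun i => (hzx i).trans (by linarith)
    calc ∫⁻ y in cube z (L / 4), ‖f y - mS‖ₑ ∂μ
        ≤ ∫⁻ y in cube z (L / 4), (‖f y - mz‖ₑ + ENNReal.ofReal (8 * c * K)) ∂μ := by
          refine lintegral_mono fun y => ?_
          have h3 : f y - mS = (f y - mz) + (mz - mS) := by ring
          rw [h3]
          refine (enorm_add_le _ _).trans (add_le_add le_rfl ?_)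
          rw [← ofReal_norm]
          exact ENNReal.ofReal_le_ofReal h1
      _ = (∫⁻ y in cube z (L / 4), ‖f y - mz‖ₑ ∂μ)
            + ENNReal.ofReal (8 * c * K) * μ (cube z (L / 4)) := by
          rw [lintegral_add_right _ measurable_const]
          simp
      _ ≤ ENNReal.ofReal K * μ (cube z (2 * (L / 4)))
            + ENNReal.ofReal (8 * c * K) * μ (cube z (2 * (L / 4))) := by
          refine add_le_add (h.osc z hz _ (by positivity)) ?_
          gcongr
          exact cube_mono z (by linarith)
      _ = ENNReal.ofReal (K + 8 * c * K) * μ (cube z (2 * (L / 4))) := by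
          rw [← add_mul, ENNReal.ofReal_add hK (by positivity)]
      _ ≤ ENNReal.ofReal (9 * c * K) * (ENNReal.ofReal β * μ (cube x L)) := by
          gcongr
          · nlinarith
          · exact (measure_mono h2).trans hxL
  refine (setLIntegral_cube_le hL key).trans_eq ?_
  have h13 : (13 : ℝ≥0∞) ^ d = ENNReal.ofReal (13 ^ d) := by
    rw [ENNReal.ofReal_pow (by norm_num)]; norm_num
  rw [h13, ← mul_assoc, ← mul_assoc, ← ENNReal.ofReal_mul (by positivity),
    ← ENNReal.ofReal_mul (by positivity)]
  congr 2
  ring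

/-- Among the doubling cubes centered at `x` over which the mean of `f` exceeds `t`, the side
lengths are bounded if `t^q μ(ℝ^d) > ‖f‖_q^q`; hence there is one of almost maximal size. -/
lemma HasGrowth.exists_almost_maximal (hG : HasGrowth μ n C) (hf : AEStronglyMeasurable f μ)
    {q t : ℝ} (hq : 1 ≤ q) (ht : ∫⁻ y, ‖f y‖ₑ ^ q ∂μ < ENNReal.ofReal t ^ q * μ univ)
    (hx : x ∈ levelSet μ β f t) :
    ∃ l, 0 < l ∧ IsDbl μ β x l ∧ t < ‖⨍ y in cube x l, f y ∂μ‖ ∧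
      ∀ l', 2 * l ≤ l' → IsDbl μ β x l' → ‖⨍ y in cube x l', f y ∂μ‖ ≤ t := by
  set S := {l | 0 < l ∧ IsDbl μ β x l ∧ t < ‖⨍ y in cube x l, f y ∂μ‖} with hS
  have hne : S.Nonempty := hx.2
  have hmono : Monotone fun k : ℕ => cube x (k : ℝ) :=
    fun i j hij => cube_mono x (Nat.cast_le.2 hij)
  have huniv : ⋃ k : ℕ, cube x (k : ℝ) = univ := by
    refine eq_univ_of_forall fun y => ?_
    obtain ⟨k, hk⟩ := exists_nat_ge (2 * ‖WithLp.ofLp y - WithLp.ofLp x‖)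
    refine mem_iUnion.2 ⟨k, fun i => ?_⟩
    have h1 := norm_le_pi_norm (WithLp.ofLp y - WithLp.ofLp x) i
    rw [Pi.sub_apply, Real.norm_eq_abs] at h1
    linarith
  rw [← huniv, hmono.measure_iUnion, ENNReal.mul_iSup] at ht
  obtain ⟨k, hk⟩ := lt_iSup_iff.1 ht
  have hbdd : BddAbove S := by
    refine ⟨k, fun l hl => ?_⟩
    by_contra! hkl
    have h1 := (hG.enorm_average_rpow_mul_le hf hq x l).trans (setLIntegral_le_lintegral _ _)
    refine absurd (hk.trans_le (le_trans ?_ h1)) (lt_irrefl _)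
    gcongr
    · rw [← ofReal_norm]
      exact ENNReal.ofReal_le_ofReal hl.2.2.le
    · exact cube_mono x hkl.le
  have hpos : 0 < sSup S := by
    obtain ⟨l, hl⟩ := hne
    exact hl.1.trans_le (le_csSup hbdd hl)
  obtain ⟨l, hl, hlt⟩ := exists_lt_of_lt_csSup hne (half_lt_self hpos)
  refine ⟨l, hl.1, hl.2.1, hl.2.2, fun l' hl' hd => ?_⟩
  by_contra! hcon
  have h1 : l' ≤ sSup S := le_csSup hbdd ⟨by linarith [hl.1], hd, hcon⟩
  linarith

/-- The good-`λ` inequality: for `f` with oscillation constant `K`, the level set `{N f > 4t}` fills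
only a fraction `O(K/t)` of the level set `{N f > t}`. -/
lemma HasOsc.measure_levelSet_le (h : HasOsc μ β f K c) (hG : HasGrowth μ n C) (hC : 0 ≤ C)
    (hβ : 2 ^ n < β) (hB0 : 0 ≤ B)
    (hB : IsCoveringConst d B)
    (hf : LocallyIntegrable f μ) {q t : ℝ} (hq : 1 ≤ q) (hK : 0 ≤ K) (hc : 1 ≤ c)
    (ht0 : 0 < t) (htK : 4 * c * K ≤ t)
    (ht : ∫⁻ y, ‖f y‖ₑ ^ q ∂μ < ENNReal.ofReal t ^ q * μ univ) :
    μ (levelSet μ β f (4 * t))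
      ≤ ENNReal.ofReal (B * (B * (13 ^ d * (9 * c * β) * K / (2 * t)))) * μ (levelSet μ β f t) := by
  have hβ0 : 0 < β := lt_trans (by positivity) hβ
  have hcK : 0 ≤ c * K := by positivity
  have hfm := hf.aestronglyMeasurable
  set η := B * (13 ^ d * (9 * c * β) * K / (2 * t)) with hη
  have hη0 : 0 ≤ η := by positivity
  have ht2 : ∫⁻ y, ‖f y‖ₑ ^ q ∂μ < ENNReal.ofReal (2 * t) ^ q * μ univ := by
    refine ht.trans_le ?_
    gcongr
    linarith
  have key : ∀ x ∈ levelSet μ β f (4 * t), ∃ L, 0 < L ∧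
      cube x L ⊆ levelSet μ β f t ∪ μ.supportᶜ ∧
      μ (levelSet μ β f (4 * t) ∩ cube x L) ≤ (ENNReal.ofReal η • μ) (cube x L) := by
    intro x hx4
    have hx : x ∈ μ.support := hx4.1
    obtain ⟨l, hl, hdl, hml, hmax⟩ := hG.exists_almost_maximal hfm hq ht2
      (levelSet_mono (by linarith) hx4 : x ∈ levelSet μ β f (2 * t))
    set L := dblSide μ β x (2 ^ 1 * l) with hLdef
    have hlL : 2 * l ≤ L :=
      (by ring : 2 * l = 2 ^ 1 * l).trans_le (le_dblSide (by positivity))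
    have hL : 0 < L := by linarith
    have hdL : IsDbl μ β x L := hG.isDbl_dblSide hC hβ hx (by positivity)
    have hmL : ‖⨍ y in cube x L, f y ∂μ‖ ≤ 2 * t := hmax L hlL hdL
    have hmL' : 2 * t - 2 * (c * K) < ‖⨍ y in cube x L, f y ∂μ‖ := by
      have h1 := h.comp x hx x hx l hl 1 hdl fun i => by simp; linarith
      have h2 := norm_sub_norm_le (⨍ y in cube x l, f y ∂μ) (⨍ y in cube x L, f y ∂μ)
      push_cast at h1
      linarith
    refine ⟨L, hL, fun y hy => ?_, ?_⟩
    · by_cases hys : y ∈ μ.support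
      · refine Or.inl ⟨hys, dblSide μ β y (2 ^ 1 * L), dblSide_pos (by positivity),
          hG.isDbl_dblSide hC hβ hys (by positivity), ?_⟩
        have h1 := h.comp x hx y hys L hL 1 hdL fun i => by
          rw [abs_sub_comm]; exact (hy i).trans_eq (by ring)
        have h2 := norm_sub_norm_le (⨍ y in cube x L, f y ∂μ)
          (⨍ w in cube y (dblSide μ β y (2 ^ 1 * L)), f w ∂μ)
        push_cast at h1
        linarith
      · exact Or.inr hys
    · set m := ⨍ y in cube x L, f y ∂μ with hm
      have h2t0 : ENNReal.ofReal (2 * t) ≠ 0 := by simpa using ht0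
      -- The weak type `(1, 1)` inequality for `f - m` on `(3/2) S`, where `S` is the cube with
      -- center `x` and side length `L`.
      have h1 := hB μ ((ENNReal.ofReal (2 * t))⁻¹ • μ.withDensity fun y => ‖f y - m‖ₑ)
        (levelSet μ β f (4 * t) ∩ cube x L) (cube x (3 / 2 * L)) ?_
      · refine h1.trans ?_
        rw [Measure.smul_apply, smul_eq_mul, withDensity_apply _ (measurableSet_cube _ _),
          Measure.smul_apply, smul_eq_mul]
        calc ENNReal.ofReal B * ((ENNReal.ofReal (2 * t))⁻¹
                * ∫⁻ y in cube x (3 / 2 * L), ‖f y - m‖ₑ ∂μ)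
            ≤ ENNReal.ofReal B * ((ENNReal.ofReal (2 * t))⁻¹
                * (ENNReal.ofReal (13 ^ d * (9 * c * β) * K) * μ (cube x L))) := by
              gcongr
              exact h.setLIntegral_le hG hC hβ hK hc hL hx hdL
          _ = ENNReal.ofReal η * μ (cube x L) := by
              rw [hη, ENNReal.ofReal_mul hB0, ENNReal.ofReal_div_of_pos (by positivity),
                ENNReal.div_eq_inv_mul]
              ring
      · rintro y ⟨⟨hys, l', hl', hdl', hml'⟩, hyx⟩
        -- A cube with `l' ≥ L / 2` would contradict the almost maximality of `l`.
        have hl'L : l' < L / 2 := by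
          by_contra! hcon
          have h1 := h.comp y hys x hx l' hl' 2 hdl' fun i => (hyx i).trans (by linarith)
          have h2 := norm_sub_norm_le (⨍ w in cube y l', f w ∂μ)
            (⨍ w in cube x (dblSide μ β x (2 ^ 2 * l')), f w ∂μ)
          have h3 : 2 ^ 2 * l' ≤ dblSide μ β x (2 ^ 2 * l') := le_dblSide (by positivity)
          have h4 := hmax (dblSide μ β x (2 ^ 2 * l')) (by linarith)
            (hG.isDbl_dblSide hC hβ hx (by positivity))
          push_cast at h1
          linarith
        refine ⟨l', hl', cube_subset fun i => (hyx i).trans (by linarith),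
          (measure_mono inter_subset_right).trans ?_⟩
        rw [Measure.smul_apply, smul_eq_mul, withDensity_apply _ (measurableSet_cube _ _),
          ← ENNReal.mul_le_iff_le_inv h2t0 ENNReal.ofReal_ne_top]
        have h1 := hG.enorm_average_rpow_mul_le (f := fun y => f y - m)
          (hfm.sub aestronglyMeasurable_const) le_rfl y l'
        simp only [ENNReal.rpow_one] at h1
        refine le_trans ?_ h1
        gcongr
        have h2 : ⨍ w in cube y l', (f w - m) ∂μ = (⨍ w in cube y l', f w ∂μ) - m := by
          have h3 : IsFiniteMeasure (μ.restrict (cube y l')) :=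
            ⟨by simpa using hG.measure_cube_lt_top y l'⟩
          have h4 : μ.real (cube y l') ≠ 0 :=
            (ENNReal.toReal_pos (measure_cube_pos hys hl').ne' (hG.measure_cube_lt_top _ _).ne).ne'
          rw [setAverage_eq, setAverage_eq, integral_sub (integrableOn_cube hf y l')
            (integrable_const m), smul_sub, setIntegral_const, smul_smul, inv_mul_cancel₀ h4,
            one_smul]
        rw [h2, ← ofReal_norm]
        refine ENNReal.ofReal_le_ofReal ?_
        have h3 := norm_sub_norm_le (⨍ w in cube y l', f w ∂μ) m
        linarith
  have hE := hG.isLocallyFiniteMeasure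
  have h1 := hB μ (ENNReal.ofReal η • μ) _ _ key
  rw [Measure.smul_apply, smul_eq_mul, ← mul_assoc, ← ENNReal.ofReal_mul hB0] at h1
  refine h1.trans (mul_le_mul' le_rfl ?_)
  refine (measure_union_le _ _).trans_eq ?_
  rw [Measure.measure_compl_support, add_zero]

end

/-! ### From distributional inequalities to `L^r` norms -/

lemma inv_ofReal_rpow {t q : ℝ} (ht : 0 < t) :
    (ENNReal.ofReal t ^ q)⁻¹ = ENNReal.ofReal (t ^ (-q)) := by
  rw [ENNReal.ofReal_rpow_of_pos ht, ← ENNReal.ofReal_inv_of_pos (by positivity),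
    Real.rpow_neg ht.le]

lemma lintegral_comp_mul_left {φ : ℝ → ℝ≥0∞} (hφ : Measurable φ) {c : ℝ} (hc : 0 < c) :
    ∫⁻ s, φ s = ENNReal.ofReal c * ∫⁻ s, φ (c * s) := by
  rw [← lintegral_map hφ (measurable_const_mul c), Real.map_volume_mul_left hc.ne',
    lintegral_smul_measure, smul_eq_mul, ← mul_assoc, ← ENNReal.ofReal_mul hc.le,
    abs_of_pos (by positivity), mul_inv_cancel₀ hc.ne', ENNReal.ofReal_one, one_mul]

/-- Integration of a good-`λ` inequality. The a priori bound `a(s) = O(s^{-q})` with `q < ρ` makes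
the integrals over `(0, Λ]` finite, so that the term with `η` can be absorbed. -/
lemma lintegral_le_of_goodLambda {a w : ℝ → ℝ≥0∞} (ha : Antitone a) {M : ℝ≥0∞} (hM : M ≠ ∞)
    {q ρ η : ℝ} (hqρ : q < ρ) (hη : 10 ^ ρ * η ≤ 1 / 2)
    (haM : ∀ s, 0 < s → a s ≤ M * ENNReal.ofReal (s ^ (-q)))
    (haw : ∀ s, 0 < s → a (10 * s) ≤ ENNReal.ofReal η * a s + w s) :
    ∫⁻ s in Ioi 0, a s * ENNReal.ofReal (s ^ (ρ - 1))
      ≤ 2 * ENNReal.ofReal (10 ^ ρ) * ∫⁻ s in Ioi 0, w s * ENNReal.ofReal (s ^ (ρ - 1)) := by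
  have ham : Measurable a := ha.measurable
  have hψ : Measurable fun s => a s * ENNReal.ofReal (s ^ (ρ - 1)) := by fun_prop
  set W := ∫⁻ s in Ioi 0, w s * ENNReal.ofReal (s ^ (ρ - 1)) with hW
  set J : ℝ → ℝ≥0∞ := fun Λ => ∫⁻ s in Ioc 0 Λ, a s * ENNReal.ofReal (s ^ (ρ - 1)) with hJ
  have hJm : Monotone J := fun x y hxy => lintegral_mono_set (Ioc_subset_Ioc_right hxy)
  have hJfin : ∀ Λ, 0 < Λ → J Λ ≠ ∞ := by
    intro Λ hΛ
    have h1 : IntegrableOn (fun s : ℝ => s ^ (ρ - 1 - q)) (Ioc 0 Λ) := by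
      rw [← intervalIntegrable_iff_integrableOn_Ioc_of_le hΛ.le]
      exact intervalIntegral.intervalIntegrable_rpow' (by linarith)
    have h2 : J Λ ≤ ∫⁻ s in Ioc 0 Λ, M * ENNReal.ofReal (s ^ (ρ - 1 - q)) := by
      refine setLIntegral_mono' measurableSet_Ioc fun s hs => ?_
      calc a s * ENNReal.ofReal (s ^ (ρ - 1))
          ≤ M * ENNReal.ofReal (s ^ (-q)) * ENNReal.ofReal (s ^ (ρ - 1)) := by
            gcongr; exact haM s hs.1
        _ = M * ENNReal.ofReal (s ^ (ρ - 1 - q)) := by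
            rw [mul_assoc, ← ENNReal.ofReal_mul (Real.rpow_nonneg hs.1.le _),
              ← Real.rpow_add hs.1]
            congr 3
            ring
    refine (h2.trans_lt ?_).ne
    rw [lintegral_const_mul' _ _ hM]
    exact ENNReal.mul_lt_top hM.lt_top h1.setLIntegral_lt_top
  have hscale : ∀ Λ, J (10 * Λ) = ENNReal.ofReal (10 ^ ρ) *
      ∫⁻ s in Ioc 0 Λ, a (10 * s) * ENNReal.ofReal (s ^ (ρ - 1)) := by
    intro Λ
    simp only [hJ]
    rw [← lintegral_indicator measurableSet_Ioc, lintegral_comp_mul_left (c := 10)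
      (hψ.indicator measurableSet_Ioc) (by norm_num),
      ← lintegral_indicator measurableSet_Ioc, ← lintegral_const_mul' _ _ ENNReal.ofReal_ne_top,
      ← lintegral_const_mul' _ _ ENNReal.ofReal_ne_top]
    refine lintegral_congr fun s => ?_
    by_cases hs : s ∈ Ioc 0 Λ
    · have hs' : 10 * s ∈ Ioc 0 (10 * Λ) := ⟨by linarith [hs.1], by linarith [hs.2]⟩
      rw [indicator_of_mem hs, indicator_of_mem hs', Real.mul_rpow (by norm_num) hs.1.le,
        ENNReal.ofReal_mul (by positivity), mul_left_comm, mul_left_comm (ENNReal.ofReal (10 ^ ρ))]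
      congr 1
      rw [← mul_assoc, ← ENNReal.ofReal_mul (by norm_num)]
      congr 2
      rw [Real.rpow_sub_one (by norm_num)]
      ring
    · have hs' : 10 * s ∉ Ioc 0 (10 * Λ) := fun h =>
        hs ⟨by linarith [h.1], by linarith [h.2]⟩
      rw [indicator_of_notMem hs, indicator_of_notMem hs', mul_zero, mul_zero]
  have hbound : ∀ Λ, 0 < Λ → J Λ ≤ 2 * ENNReal.ofReal (10 ^ ρ) * W := by
    intro Λ hΛ
    have h1 : J Λ ≤ J Λ / 2 + ENNReal.ofReal (10 ^ ρ) * W := by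
      calc J Λ ≤ J (10 * Λ) := hJm (by linarith)
        _ = ENNReal.ofReal (10 ^ ρ) *
            ∫⁻ s in Ioc 0 Λ, a (10 * s) * ENNReal.ofReal (s ^ (ρ - 1)) := hscale Λ
        _ ≤ ENNReal.ofReal (10 ^ ρ) * ∫⁻ s in Ioc 0 Λ,
            (ENNReal.ofReal η * (a s * ENNReal.ofReal (s ^ (ρ - 1)))
              + w s * ENNReal.ofReal (s ^ (ρ - 1))) := by
            refine mul_le_mul' le_rfl (setLIntegral_mono' measurableSet_Ioc fun s hs => ?_)
            rw [← mul_assoc, ← add_mul]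
            exact mul_le_mul' (haw s hs.1) le_rfl
        _ = ENNReal.ofReal (10 ^ ρ) * (ENNReal.ofReal η * J Λ
            + ∫⁻ s in Ioc 0 Λ, w s * ENNReal.ofReal (s ^ (ρ - 1))) := by
            rw [lintegral_add_left (by fun_prop), lintegral_const_mul' _ _ ENNReal.ofReal_ne_top]
        _ ≤ ENNReal.ofReal (10 ^ ρ) * (ENNReal.ofReal η * J Λ + W) := by
            gcongr
            exact lintegral_mono_set Ioc_subset_Ioi_self
        _ = ENNReal.ofReal (10 ^ ρ * η) * J Λ + ENNReal.ofReal (10 ^ ρ) * W := by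
            rw [mul_add, ← mul_assoc, ← ENNReal.ofReal_mul (by positivity)]
        _ ≤ ENNReal.ofReal (1 / 2) * J Λ + ENNReal.ofReal (10 ^ ρ) * W := by
            gcongr
        _ = J Λ / 2 + ENNReal.ofReal (10 ^ ρ) * W := by
            rw [ENNReal.ofReal_div_of_pos two_pos, ENNReal.ofReal_one, ENNReal.ofReal_ofNat,
              ENNReal.div_eq_inv_mul, mul_one, ENNReal.div_eq_inv_mul]
    have h2 : J Λ / 2 ≠ ∞ := ENNReal.div_ne_top (hJfin Λ hΛ) two_ne_zero
    nth_rewrite 1 [← ENNReal.add_halves (J Λ)] at h1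
    rw [ENNReal.add_le_add_iff_left h2, ENNReal.div_le_iff two_ne_zero ENNReal.ofNat_ne_top] at h1
    exact h1.trans_eq (by ring)
  have hU : Ioi (0 : ℝ) = ⋃ k : ℕ, Ioc 0 ((k : ℝ) + 1) := by
    ext s
    simp only [mem_Ioi, mem_iUnion, mem_Ioc, exists_and_left, iff_self_and]
    exact fun _ => (exists_nat_ge s).imp fun k hk => by linarith
  have hmono : Monotone fun k : ℕ => Ioc (0 : ℝ) ((k : ℝ) + 1) := fun i j hij =>
    Ioc_subset_Ioc_right (by gcongr)
  rw [hU, setLIntegral_iUnion_of_directed _ hmono.directed_le]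
  exact iSup_le fun k => hbound _ (by positivity)

/-- Fubini in layer-cake form: the tails `∫_{‖f‖ > δs} ‖f‖^q` integrate to the `ρ`-th power of the
`L^ρ` norm. It is the layer-cake formula for the measure `‖f‖^q μ` and the exponent `ρ - q`. -/
lemma lintegral_tail_eq {α E : Type*} [MeasurableSpace α] [NormedAddCommGroup E] (μ : Measure α)
    {f : α → E} (hf : StronglyMeasurable f) {q ρ δ : ℝ} (hq : 0 < q) (hqρ : q < ρ) (hδ : 0 < δ) :
    ∫⁻ s in Ioi 0, (ENNReal.ofReal (s ^ (-q)) * ∫⁻ x in {x | δ * s < ‖f x‖}, ‖f x‖ₑ ^ q ∂μ)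
        * ENNReal.ofReal (s ^ (ρ - 1))
      = (ENNReal.ofReal (ρ - q))⁻¹ * ENNReal.ofReal ((δ⁻¹) ^ (ρ - q)) * ∫⁻ x, ‖f x‖ₑ ^ ρ ∂μ := by
  set ν := μ.withDensity fun x => ‖f x‖ₑ ^ q with hν
  have hmeas : ∀ s, MeasurableSet {x | δ * s < ‖f x‖} := fun s =>
    measurableSet_lt measurable_const hf.norm.measurable
  have hm : Measurable fun x => ‖f x‖ₑ ^ q := hf.enorm.pow_const q
  have h1 := lintegral_rpow_eq_lintegral_meas_lt_mul ν (f := fun x => δ⁻¹ * ‖f x‖)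
    (Eventually.of_forall fun x => by positivity) (hf.norm.measurable.const_mul _).aemeasurable
    (sub_pos.2 hqρ)
  have h2 : ∫⁻ x, ENNReal.ofReal ((δ⁻¹ * ‖f x‖) ^ (ρ - q)) ∂ν
      = ENNReal.ofReal ((δ⁻¹) ^ (ρ - q)) * ∫⁻ x, ‖f x‖ₑ ^ ρ ∂μ := by
    rw [lintegral_withDensity_eq_lintegral_mul _ hm
      (((hf.norm.measurable.const_mul _).pow_const _).ennreal_ofReal),
      ← lintegral_const_mul' _ _ ENNReal.ofReal_ne_top]
    refine lintegral_congr fun x => ?_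
    rw [Pi.mul_apply, Real.mul_rpow (by positivity) (by positivity),
      ENNReal.ofReal_mul (by positivity), mul_left_comm,
      ← ENNReal.ofReal_rpow_of_nonneg (norm_nonneg _) (by linarith), ofReal_norm,
      ← ENNReal.rpow_add_of_nonneg _ _ hq.le (by linarith)]
    congr 2
    ring
  rw [h2] at h1
  rw [mul_assoc, h1, ← mul_assoc, ENNReal.inv_mul_cancel (by simpa using hqρ) ENNReal.ofReal_ne_top,
    one_mul]
  refine setLIntegral_congr_fun measurableSet_Ioi fun s hs => ?_
  have hs0 : 0 < s := hs
  have h3 : {x | s < δ⁻¹ * ‖f x‖} = {x | δ * s < ‖f x‖} := by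
    ext x
    simp only [mem_ofPred_eq]
    rw [inv_mul_eq_div, lt_div_iff₀ hδ, mul_comm]
  rw [h3, hν, withDensity_apply _ (hmeas s), mul_comm (ENNReal.ofReal _), mul_assoc,
    ← ENNReal.ofReal_mul (by positivity), ← Real.rpow_add hs0]
  congr 3
  ring

/-! ### Interpolation -/

section

variable {𝕜 : Type*} [RCLike 𝕜] {μ : Measure (EuclideanSpace ℝ (Fin d))} {n : ℕ} {C β : ℝ}
  {p : ℝ≥0∞} [Fact (1 ≤ p)]

lemma eLpNorm_rpow_toReal {α E : Type*} [MeasurableSpace α] [NormedAddCommGroup E] {μ : Measure α}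
    {p : ℝ≥0∞} (hp0 : p ≠ 0) (hp : p ≠ ∞) (f : α → E) :
    eLpNorm f p μ ^ p.toReal = ∫⁻ x, ‖f x‖ₑ ^ p.toReal ∂μ := by
  rw [eLpNorm_eq_lintegral_rpow_enorm_toReal hp0 hp, ← ENNReal.rpow_mul, one_div,
    inv_mul_cancel₀ (ENNReal.toReal_pos hp0 hp).ne', ENNReal.rpow_one]

lemma lintegral_apply_le {α : Type*} [MeasurableSpace α] {μ : Measure α} (hp : p ≠ ∞)
    (T : Lp 𝕜 p μ →L[𝕜] Lp 𝕜 p μ) {N : ℝ} (hN : ‖T‖ ≤ N) (f : Lp 𝕜 p μ) :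
    ∫⁻ x, ‖T f x‖ₑ ^ p.toReal ∂μ
      ≤ ENNReal.ofReal N ^ p.toReal * ∫⁻ x, ‖f x‖ₑ ^ p.toReal ∂μ := by
  have hp0 : p ≠ 0 := (zero_lt_one.trans_le (Fact.out : 1 ≤ p)).ne'
  rw [← eLpNorm_rpow_toReal hp0 hp, ← eLpNorm_rpow_toReal hp0 hp,
    ← ENNReal.mul_rpow_of_nonneg _ _ ENNReal.toReal_nonneg]
  refine ENNReal.rpow_le_rpow ?_ ENNReal.toReal_nonneg
  rw [← Lp.enorm_def, ← Lp.enorm_def]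
  refine (T.le_opENorm f).trans (mul_le_mul' ?_ le_rfl)
  rw [← ofReal_norm]
  exact ENNReal.ofReal_le_ofReal hN

/-- When `s^q μ(ℝ^d)` is at most a multiple of `∫ |f|^q`, the part of `∫ |f|^q` where `|f| ≤ δs` is
negligible for small `δ`, so that `s^q μ(ℝ^d)` is controlled by the tail. -/
lemma measure_univ_le_tail {α : Type*} [MeasurableSpace α] {μ : Measure α} {f : α → 𝕜}
    (hf : StronglyMeasurable f) {q N δ s : ℝ} (hq : 1 ≤ q) (hδ : 0 ≤ δ) (hs : 0 < s)
    (hδN : δ * N ≤ 1 / 2) (hfin : ∫⁻ x, ‖f x‖ₑ ^ q ∂μ ≠ ∞)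
    (h : ENNReal.ofReal s ^ q * μ univ ≤ ENNReal.ofReal N ^ q * ∫⁻ x, ‖f x‖ₑ ^ q ∂μ) :
    μ univ ≤ 2 * ENNReal.ofReal N ^ q *
      (ENNReal.ofReal (s ^ (-q)) * ∫⁻ x in {x | δ * s < ‖f x‖}, ‖f x‖ₑ ^ q ∂μ) := by
  have hq0 : 0 ≤ q := zero_le_one.trans hq
  have hmeas : MeasurableSet {x | δ * s < ‖f x‖} :=
    measurableSet_lt measurable_const hf.norm.measurable
  set I := ∫⁻ x, ‖f x‖ₑ ^ q ∂μ with hI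
  set I₂ := ∫⁻ x in {x | δ * s < ‖f x‖}, ‖f x‖ₑ ^ q ∂μ with hI₂
  have h1 : ∫⁻ x in {x | δ * s < ‖f x‖}ᶜ, ‖f x‖ₑ ^ q ∂μ ≤ I / 2 := by
    calc ∫⁻ x in {x | δ * s < ‖f x‖}ᶜ, ‖f x‖ₑ ^ q ∂μ
        ≤ ∫⁻ _x in {x | δ * s < ‖f x‖}ᶜ, ENNReal.ofReal (δ * s) ^ q ∂μ := by
          refine setLIntegral_mono' hmeas.compl fun x hx => ?_
          refine ENNReal.rpow_le_rpow ?_ hq0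
          rw [← ofReal_norm]
          exact ENNReal.ofReal_le_ofReal (not_lt.1 hx)
      _ ≤ ENNReal.ofReal (δ * s) ^ q * μ univ := by
          rw [lintegral_const, Measure.restrict_apply_univ]
          exact mul_le_mul' le_rfl (measure_mono (subset_univ _))
      _ = ENNReal.ofReal δ ^ q * (ENNReal.ofReal s ^ q * μ univ) := by
          rw [ENNReal.ofReal_mul hδ, ENNReal.mul_rpow_of_nonneg _ _ hq0, mul_assoc]
      _ ≤ ENNReal.ofReal δ ^ q * (ENNReal.ofReal N ^ q * I) := by gcongr
      _ = ENNReal.ofReal (δ * N) ^ q * I := by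
          rw [ENNReal.ofReal_mul hδ, ENNReal.mul_rpow_of_nonneg _ _ hq0, mul_assoc]
      _ ≤ ENNReal.ofReal (1 / 2) ^ q * I := by gcongr
      _ ≤ ENNReal.ofReal (1 / 2) ^ (1 : ℝ) * I := by
          refine mul_le_mul' (ENNReal.rpow_le_rpow_of_exponent_ge ?_ hq) le_rfl
          exact ENNReal.ofReal_le_one.2 (by norm_num)
      _ = I / 2 := by
          rw [ENNReal.rpow_one, ENNReal.ofReal_div_of_pos two_pos, ENNReal.ofReal_one,
            ENNReal.ofReal_ofNat, ENNReal.div_eq_inv_mul, mul_one, ENNReal.div_eq_inv_mul]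
  have h2 : I ≤ 2 * I₂ := by
    have h3 : I = I₂ + ∫⁻ x in {x | δ * s < ‖f x‖}ᶜ, ‖f x‖ₑ ^ q ∂μ :=
      (lintegral_add_compl _ hmeas).symm
    have h4 : I / 2 + I / 2 ≤ I₂ + I / 2 := by
      rw [ENNReal.add_halves]
      exact h3.trans_le (add_le_add le_rfl h1)
    rw [ENNReal.add_le_add_iff_right (ENNReal.div_ne_top hfin two_ne_zero),
      ENNReal.div_le_iff two_ne_zero ENNReal.ofNat_ne_top] at h4
    exact h4.trans_eq (mul_comm _ _)
  have hs0 : ENNReal.ofReal s ^ q ≠ 0 := by simp [hs]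
  have hs1 : ENNReal.ofReal s ^ q ≠ ∞ := by simp [hq0]
  rw [ENNReal.mul_le_iff_le_inv hs0 hs1, inv_ofReal_rpow hs] at h
  calc μ univ ≤ ENNReal.ofReal (s ^ (-q)) * (ENNReal.ofReal N ^ q * (2 * I₂)) :=
        h.trans (by gcongr)
    _ = _ := by ring

/-- The good-`λ` inequality for `T f`: at height `s` the function `f` is split into a part bounded
by `δs`, which `T` maps into `RBMO` with a norm small compared to `s`, and a tail, to which the
boundedness of `T` on `L^p` and the weak type inequality of the maximal function apply. -/
lemma HasGrowth.exists_goodLambda (hG : HasGrowth μ n C) (hC : 0 ≤ C) (hβ : 2 ^ n < β)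
    (hp : p ≠ ∞) (T : Lp 𝕜 p μ →L[𝕜] Lp 𝕜 p μ) {A : ℝ}
    (hT : ∀ f : Lp 𝕜 p μ, MemLp f ∞ μ →
      MemRBMO μ n β (T f) ∧ rbmoNorm μ n β (T f) ≤ A * (eLpNorm f ∞ μ).toReal)
    {η : ℝ} (hη : 0 < η) :
    ∃ δ : ℝ, 0 < δ ∧ ∃ D : ℝ≥0∞, D ≠ ∞ ∧ ∀ (f : Lp 𝕜 p μ) (s : ℝ), 0 < s →
      μ (levelSet μ β (T f) (10 * s)) ≤ ENNReal.ofReal η * μ (levelSet μ β (T f) s)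
        + D * (ENNReal.ofReal (s ^ (-p.toReal))
          * ∫⁻ x in {x | δ * s < ‖f x‖}, ‖f x‖ₑ ^ p.toReal ∂μ) := by
  obtain ⟨B, hB0, hB⟩ := exists_isCoveringConst d
  have hE := hG.isLocallyFiniteMeasure
  have hp1 : 1 ≤ p := Fact.out
  have hp0 : p ≠ 0 := (zero_lt_one.trans_le hp1).ne'
  have hβ0 : 0 < β := lt_trans (by positivity) hβ
  set q := p.toReal with hqdef
  have hq : 1 ≤ q := by simpa using ENNReal.toReal_mono hp hp1
  have hq0 : 0 ≤ q := zero_le_one.trans hq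
  set c := compConst n β C with hcdef
  have hc : 1 ≤ c := one_le_compConst hC hβ
  set A' := |A| + 1 with hA'
  have hA'0 : 0 < A' := by positivity
  set N := ‖T‖ + 1 with hN
  have hN0 : 0 < N := by positivity
  set b := B * (B * (13 ^ d * (9 * c * β) * A')) with hb
  have hb0 : 0 ≤ b := by positivity
  -- The smallness requirements on `θ`; the splitting height is `θ t` with `t = 2s`.
  obtain ⟨θ, hθ0, hθ1, hθ2, hθ3⟩ : ∃ θ : ℝ, 0 < θ ∧ 4 * c * A' * θ ≤ 1 ∧
      b * θ ≤ min η 1 ∧ 2 * θ * N ≤ 1 / 2 := by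
    refine ⟨1 / (4 * c * A' + b / min η 1 + 4 * N), by positivity, ?_, ?_, ?_⟩
    · rw [mul_one_div, div_le_one (by positivity)]
      have : 0 ≤ b / min η 1 := by positivity
      linarith
    · have h0 : 0 < min η 1 := by positivity
      rw [mul_one_div, div_le_iff₀ (by positivity), mul_add, mul_add, mul_div_cancel₀ _ h0.ne']
      have h1 : 0 ≤ min η 1 * (4 * c * A') := by positivity
      have h2 : 0 ≤ min η 1 * (4 * N) := by positivity
      linarith
    · have : 0 ≤ b / min η 1 := by positivity
      have h1 : 0 ≤ 4 * c * A' := by positivity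
      rw [mul_one_div, div_mul_eq_mul_div, div_le_iff₀ (by positivity)]
      linarith
  refine ⟨2 * θ, by positivity, 2 * ENNReal.ofReal (B + 1) * ENNReal.ofReal N ^ q, ?_,
    fun f s hs => ?_⟩
  · exact ENNReal.mul_ne_top (ENNReal.mul_ne_top ENNReal.ofNat_ne_top ENNReal.ofReal_ne_top)
      (ENNReal.rpow_ne_top_of_nonneg hq0 ENNReal.ofReal_ne_top)
  set I₂ := ∫⁻ x in {x | 2 * θ * s < ‖f x‖}, ‖f x‖ₑ ^ q ∂μ with hI₂
  have hfin : ∫⁻ x, ‖f x‖ₑ ^ q ∂μ ≠ ∞ := by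
    rw [← eLpNorm_rpow_toReal hp0 hp]
    exact ENNReal.rpow_ne_top_of_nonneg hq0 (Lp.eLpNorm_ne_top f)
  rcases le_or_gt (ENNReal.ofReal s ^ q * μ univ)
    (ENNReal.ofReal N ^ q * ∫⁻ x, ‖f x‖ₑ ^ q ∂μ) with hlow | hhigh
  · calc μ (levelSet μ β (T f) (10 * s)) ≤ μ univ := measure_mono (subset_univ _)
      _ ≤ 2 * ENNReal.ofReal N ^ q * (ENNReal.ofReal (s ^ (-q)) * I₂) :=
          measure_univ_le_tail (Lp.stronglyMeasurable f) hq (by positivity) hs hθ3 hfin hlow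
      _ = 2 * 1 * ENNReal.ofReal N ^ q * (ENNReal.ofReal (s ^ (-q)) * I₂) := by rw [mul_one]
      _ ≤ 2 * ENNReal.ofReal (B + 1) * ENNReal.ofReal N ^ q *
            (ENNReal.ofReal (s ^ (-q)) * I₂) := by
          gcongr
          rw [← ENNReal.ofReal_one]
          exact ENNReal.ofReal_le_ofReal (by linarith)
      _ ≤ _ := le_add_self
  · have hmeas : MeasurableSet {x | 2 * θ * s < ‖f x‖} :=
      measurableSet_lt measurable_const (Lp.stronglyMeasurable f).norm.measurable
    have hm₁ : MemLp ({x | 2 * θ * s < ‖f x‖}ᶜ.indicator f) p μ :=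
      (Lp.memLp f).indicator hmeas.compl
    have hm₂ : MemLp ({x | 2 * θ * s < ‖f x‖}.indicator f) p μ := (Lp.memLp f).indicator hmeas
    set F₁ := hm₁.toLp with hF₁
    set F₂ := hm₂.toLp with hF₂
    have hsum : F₁ + F₂ = f := by
      rw [hF₁, hF₂, ← MemLp.toLp_add]
      refine Lp.ext ((MemLp.coeFn_toLp _).trans (Eventually.of_forall fun x => ?_))
      rw [Set.indicator_compl_add_self]
    have hbound : ∀ᵐ x ∂μ, ‖F₁ x‖ ≤ 2 * θ * s := by
      filter_upwards [hm₁.coeFn_toLp] with x hx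
      rw [hF₁, hx]
      by_cases h : 2 * θ * s < ‖f x‖
      · rw [indicator_of_notMem (by simpa using h), norm_zero]
        positivity
      · rw [indicator_of_mem (by simpa using h)]
        exact not_lt.1 h
    have hsup : eLpNorm F₁ ∞ μ ≤ ENNReal.ofReal (2 * θ * s) := by
      rw [eLpNorm_exponent_top]
      exact eLpNormEssSup_le_of_ae_bound hbound
    have hmem : MemLp F₁ ∞ μ := ⟨Lp.aestronglyMeasurable F₁, hsup.trans_lt ENNReal.ofReal_lt_top⟩
    have hF₁le : ∫⁻ x, ‖F₁ x‖ₑ ^ q ∂μ ≤ ∫⁻ x, ‖f x‖ₑ ^ q ∂μ := by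
      refine lintegral_mono_ae ?_
      filter_upwards [hm₁.coeFn_toLp] with x hx
      rw [hF₁, hx]
      exact ENNReal.rpow_le_rpow (enorm_indicator_le_enorm_self _ _) hq0
    have hF₂eq : ∫⁻ x, ‖F₂ x‖ₑ ^ q ∂μ = I₂ := by
      rw [hI₂, ← lintegral_indicator hmeas]
      refine lintegral_congr_ae ?_
      filter_upwards [hm₂.coeFn_toLp] with x hx
      rw [hF₂, hx]
      by_cases h : x ∈ {x | 2 * θ * s < ‖f x‖}
      · rw [indicator_of_mem h, indicator_of_mem h]
      · rw [indicator_of_notMem h, indicator_of_notMem h, enorm_zero,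
          ENNReal.zero_rpow_of_pos (by linarith)]
    have hloc : ∀ g : Lp 𝕜 p μ, LocallyIntegrable g μ := fun g => (Lp.memLp g).locallyIntegrable hp1
    -- The tail, at any height `t ≥ s`.
    have htail : ∀ G : Lp 𝕜 p μ, ∫⁻ x, ‖G x‖ₑ ^ q ∂μ = I₂ → ∀ t, s ≤ t →
        μ (levelSet μ β (T G) t)
          ≤ ENNReal.ofReal B * (ENNReal.ofReal N ^ q * (ENNReal.ofReal (s ^ (-q)) * I₂)) := by
      intro G hG₂ t hst
      refine (measure_mono (levelSet_mono hst)).trans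
        ((hG.measure_levelSet_le hB (Lp.aestronglyMeasurable (T G)) hq hs).trans ?_)
      rw [inv_ofReal_rpow hs, mul_left_comm (ENNReal.ofReal N ^ q)]
      gcongr
      rw [← hG₂]
      exact lintegral_apply_le hp T (by linarith) G
    have hneg : ∫⁻ x, ‖(-F₂) x‖ₑ ^ q ∂μ = I₂ := by
      rw [← hF₂eq]
      refine lintegral_congr_ae ?_
      filter_upwards [Lp.coeFn_neg F₂] with x hx
      rw [hx, Pi.neg_apply, enorm_neg]
    set R := ENNReal.ofReal N ^ q * (ENNReal.ofReal (s ^ (-q)) * I₂) with hR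
    have hstep₁ : μ (levelSet μ β (T f) (10 * s))
        ≤ μ (levelSet μ β (T F₁) (4 * (2 * s))) + ENNReal.ofReal B * R := by
      have h1 : (T f : EuclideanSpace ℝ (Fin d) → 𝕜) =ᵐ[μ] T F₁ + T F₂ := by
        rw [← hsum, map_add]
        exact Lp.coeFn_add _ _
      rw [levelSet_congr h1, show 10 * s = 4 * (2 * s) + 2 * s by ring]
      refine (measure_mono (levelSet_add_subset (hloc _) (hloc _) _ _)).trans
        ((measure_union_le _ _).trans (add_le_add le_rfl ?_))
      exact htail F₂ hF₂eq _ (by linarith)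
    have hstep₂ : μ (levelSet μ β (T F₁) (2 * s))
        ≤ μ (levelSet μ β (T f) s) + ENNReal.ofReal B * R := by
      have h1 : (T F₁ : EuclideanSpace ℝ (Fin d) → 𝕜) =ᵐ[μ] T f + T (-F₂) := by
        have h2 : T F₁ = T f + T (-F₂) := by rw [← hsum, map_add, map_neg, add_neg_cancel_right]
        rw [h2]
        exact Lp.coeFn_add _ _
      rw [levelSet_congr h1, two_mul]
      refine (measure_mono (levelSet_add_subset (hloc _) (hloc _) _ _)).trans
        ((measure_union_le _ _).trans (add_le_add le_rfl ?_))
      exact htail (-F₂) hneg _ le_rfl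
    have hK : rbmoNorm μ n β (T F₁) < A' * (2 * θ * s) := by
      have h1 : (eLpNorm F₁ ∞ μ).toReal ≤ 2 * θ * s :=
        ENNReal.toReal_le_of_le_ofReal (by positivity) hsup
      have h2 : 0 < 2 * θ * s := by positivity
      calc rbmoNorm μ n β (T F₁) ≤ A * (eLpNorm F₁ ∞ μ).toReal := (hT F₁ hmem).2
        _ ≤ |A| * (2 * θ * s) := by
            refine mul_le_mul (le_abs_self A) h1 ENNReal.toReal_nonneg (abs_nonneg A)
        _ < A' * (2 * θ * s) := by rw [hA']; linarith
    obtain ⟨hK0, hRB⟩ := rbmoWith_of_rbmoNorm_lt (hT F₁ hmem).1 hK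
    have hstep₃ : μ (levelSet μ β (T F₁) (4 * (2 * s)))
        ≤ ENNReal.ofReal (b * θ / 2) * μ (levelSet μ β (T F₁) (2 * s)) := by
      have h1 := (hG.hasOsc hC hβ hK0 hRB).measure_levelSet_le hG hC hβ hB0 hB (hloc _) hq hK0 hc
        (t := 2 * s) (by positivity) ?_ ?_
      · refine h1.trans_eq ?_
        congr 2
        rw [hb, hcdef]
        field_simp
      · have : 4 * c * (A' * (2 * θ * s)) = (4 * c * A' * θ) * (2 * s) := by ring
        rw [this]
        exact mul_le_of_le_one_left (by positivity) hθ1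
      · calc ∫⁻ x, ‖T F₁ x‖ₑ ^ q ∂μ ≤ ENNReal.ofReal N ^ q * ∫⁻ x, ‖F₁ x‖ₑ ^ q ∂μ :=
              lintegral_apply_le hp T (by linarith) F₁
          _ ≤ ENNReal.ofReal N ^ q * ∫⁻ x, ‖f x‖ₑ ^ q ∂μ := by gcongr
          _ < ENNReal.ofReal s ^ q * μ univ := hhigh
          _ ≤ ENNReal.ofReal (2 * s) ^ q * μ univ := by gcongr; linarith
    have hbη : ENNReal.ofReal (b * θ / 2) ≤ ENNReal.ofReal η :=
      ENNReal.ofReal_le_ofReal (by have := min_le_left η 1; have := mul_nonneg hb0 hθ0.le; linarith)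
    have hb1 : ENNReal.ofReal (b * θ / 2) ≤ 1 :=
      ENNReal.ofReal_le_one.2
        (by have := min_le_right η 1; have := mul_nonneg hb0 hθ0.le; linarith)
    calc μ (levelSet μ β (T f) (10 * s))
        ≤ ENNReal.ofReal (b * θ / 2) * (μ (levelSet μ β (T f) s) + ENNReal.ofReal B * R)
            + ENNReal.ofReal B * R :=
          hstep₁.trans (add_le_add (hstep₃.trans (mul_le_mul' le_rfl hstep₂)) le_rfl)
      _ ≤ (ENNReal.ofReal η * μ (levelSet μ β (T f) s) + 1 * (ENNReal.ofReal B * R))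
            + ENNReal.ofReal B * R := by
          rw [mul_add]
          gcongr
      _ = ENNReal.ofReal η * μ (levelSet μ β (T f) s) + 2 * ENNReal.ofReal B * R := by ring
      _ ≤ ENNReal.ofReal η * μ (levelSet μ β (T f) s) + 2 * ENNReal.ofReal (B + 1) * R := by
          gcongr
          linarith
      _ = _ := by rw [hR]; ring

/-- The `L^ρ` bound for `T f`, for all `f ∈ L^p` (the right-hand side may be infinite). -/
lemma HasGrowth.exists_lintegral_rpow_le (hG : HasGrowth μ n C) (hC : 0 ≤ C) (hnd : n ≤ d)
    (hβ : 2 ^ d < β) (hp : p ≠ ∞) (T : Lp 𝕜 p μ →L[𝕜] Lp 𝕜 p μ) {A : ℝ}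
    (hT : ∀ f : Lp 𝕜 p μ, MemLp f ∞ μ →
      MemRBMO μ n β (T f) ∧ rbmoNorm μ n β (T f) ≤ A * (eLpNorm f ∞ μ).toReal)
    {ρ : ℝ} (hρ : p.toReal < ρ) :
    ∃ D : ℝ≥0∞, D ≠ ∞ ∧ ∀ f : Lp 𝕜 p μ,
      ∫⁻ x, ‖T f x‖ₑ ^ ρ ∂μ ≤ D * ∫⁻ x, ‖f x‖ₑ ^ ρ ∂μ := by
  have hp1 : 1 ≤ p := Fact.out
  have hp0 : p ≠ 0 := (zero_lt_one.trans_le hp1).ne'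
  have hE := hG.isLocallyFiniteMeasure
  have hq : 1 ≤ p.toReal := by simpa using ENNReal.toReal_mono hp hp1
  have hρ0 : 0 < ρ := by linarith
  obtain ⟨B, hB0, hB⟩ := exists_isCoveringConst d
  obtain ⟨δ, hδ, D, hD, hgood⟩ := hG.exists_goodLambda hC (two_pow_lt hnd hβ) hp T hT
    (η := 1 / (2 * 10 ^ ρ)) (by positivity)
  refine ⟨ENNReal.ofReal ρ * (2 * ENNReal.ofReal (10 ^ ρ) * (D * ((ENNReal.ofReal (ρ - p.toReal))⁻¹
    * ENNReal.ofReal ((δ⁻¹) ^ (ρ - p.toReal))))), ?_, fun f => ?_⟩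
  · have h1 : (ENNReal.ofReal (ρ - p.toReal))⁻¹ ≠ ∞ := by simpa using hρ
    finiteness
  have hweak : ∀ s, 0 < s → μ (levelSet μ β (T f) s)
      ≤ (ENNReal.ofReal B * ∫⁻ x, ‖T f x‖ₑ ^ p.toReal ∂μ) * ENNReal.ofReal (s ^ (-p.toReal)) := by
    intro s hs
    refine (hG.measure_levelSet_le hB (Lp.aestronglyMeasurable (T f)) hq hs).trans_eq ?_
    rw [inv_ofReal_rpow hs]
    ring
  have hfin : ENNReal.ofReal B * ∫⁻ x, ‖T f x‖ₑ ^ p.toReal ∂μ ≠ ∞ := by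
    rw [← eLpNorm_rpow_toReal hp0 hp]
    exact ENNReal.mul_ne_top ENNReal.ofReal_ne_top
      (ENNReal.rpow_ne_top_of_nonneg (by linarith) (Lp.eLpNorm_ne_top _))
  have hint := lintegral_le_of_goodLambda (a := fun s => μ (levelSet μ β (T f) s))
    (fun s t hst => measure_mono (levelSet_mono hst)) hfin hρ
    (by field_simp; exact le_rfl) hweak (hgood f)
  have hmono : ∀ s, μ {x | s < ‖T f x‖} ≤ μ (levelSet μ β (T f) s) := fun s =>
    measure_mono_ae <| (hG.ae_mem_levelSet hβ ((Lp.memLp (T f)).locallyIntegrable hp1)).mono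
      fun x hx => hx s
  calc ∫⁻ x, ‖T f x‖ₑ ^ ρ ∂μ = ∫⁻ x, ENNReal.ofReal (‖T f x‖ ^ ρ) ∂μ := by
        refine lintegral_congr fun x => ?_
        rw [← ENNReal.ofReal_rpow_of_nonneg (norm_nonneg _) hρ0.le, ofReal_norm]
    _ = ENNReal.ofReal ρ * ∫⁻ s in Ioi 0, μ {x | s < ‖T f x‖} * ENNReal.ofReal (s ^ (ρ - 1)) :=
        lintegral_rpow_eq_lintegral_meas_lt_mul μ (Eventually.of_forall fun x => norm_nonneg _)
          (Lp.stronglyMeasurable (T f)).norm.measurable.aemeasurable hρ0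
    _ ≤ ENNReal.ofReal ρ *
          ∫⁻ s in Ioi 0, μ (levelSet μ β (T f) s) * ENNReal.ofReal (s ^ (ρ - 1)) := by
        exact mul_le_mul' le_rfl (lintegral_mono fun s => mul_le_mul' (hmono s) le_rfl)
    _ ≤ _ := by
        refine (mul_le_mul' le_rfl hint).trans_eq ?_
        simp only [mul_assoc]
        rw [lintegral_const_mul' _ _ hD]
        have h1 := lintegral_tail_eq μ (Lp.stronglyMeasurable f) (by linarith : 0 < p.toReal) hρ hδ
        simp only [mul_assoc] at h1
        rw [h1]

end

/-- A linear operator on `L^p` that satisfies an `L^r` bound on `L^p ∩ L^r` extends to a bounded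
operator on `L^r`, because `L^p ∩ L^r` is dense in `L^r`. -/
lemma exists_extension {α 𝕜 : Type*} [MeasurableSpace α] [RCLike 𝕜] {μ : Measure α} {p r : ℝ≥0∞}
    [Fact (1 ≤ p)] [Fact (1 ≤ r)] (hp : p ≠ ∞) (hr : r ≠ ∞) (T : Lp 𝕜 p μ →L[𝕜] Lp 𝕜 p μ) {D : ℝ}
    (hD : 0 ≤ D) (hT : ∀ f : Lp 𝕜 p μ, eLpNorm (T f) r μ ≤ ENNReal.ofReal D * eLpNorm f r μ) :
    ∃ S : Lp 𝕜 r μ →L[𝕜] Lp 𝕜 r μ,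
      ∀ (f : Lp 𝕜 p μ) (g : Lp 𝕜 r μ), f =ᵐ[μ] g → S g =ᵐ[μ] T f := by
  have hp0 : p ≠ 0 := (zero_lt_one.trans_le (Fact.out : 1 ≤ p)).ne'
  have hr0 : r ≠ 0 := (zero_lt_one.trans_le (Fact.out : 1 ≤ r)).ne'
  let V : Submodule 𝕜 (Lp 𝕜 p μ) :=
    { carrier := {f | MemLp f r μ}
      add_mem' := fun {f g} hf hg => (hf.add hg).ae_eq (Lp.coeFn_add f g).symm
      zero_mem' := (MemLp.zero' (p := r)).ae_eq (Lp.coeFn_zero 𝕜 p μ).symm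
      smul_mem' := fun c f hf => (hf.const_smul c).ae_eq (Lp.coeFn_smul c f).symm }
  have hTV : ∀ f : V, MemLp (T f) r μ := fun f =>
    ⟨Lp.aestronglyMeasurable _, (hT f).trans_lt (ENNReal.mul_lt_top ENNReal.ofReal_lt_top f.2.2)⟩
  let e : V →ₗ[𝕜] Lp 𝕜 r μ :=
    { toFun := fun f => MemLp.toLp _ f.2
      map_add' := fun f g => Lp.ext <| by
        filter_upwards [MemLp.coeFn_toLp (f + g).2, MemLp.coeFn_toLp f.2, MemLp.coeFn_toLp g.2,
          Lp.coeFn_add (MemLp.toLp _ f.2) (MemLp.toLp _ g.2), Lp.coeFn_add f.1 g.1]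
          with x h1 h2 h3 h4 h5
        rw [h1, h4, Pi.add_apply, h2, h3, ← Pi.add_apply, ← h5]
        rfl
      map_smul' := fun c f => Lp.ext <| by
        filter_upwards [MemLp.coeFn_toLp (c • f).2, MemLp.coeFn_toLp f.2,
          Lp.coeFn_smul c (MemLp.toLp _ f.2), Lp.coeFn_smul c f.1] with x h1 h2 h3 h4
        rw [h1, RingHom.id_apply, h3, Pi.smul_apply, h2, ← Pi.smul_apply, ← h4]
        rfl }
  let F : V →ₗ[𝕜] Lp 𝕜 r μ :=
    { toFun := fun f => MemLp.toLp _ (hTV f)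
      map_add' := fun f g => Lp.ext <| by
        filter_upwards [MemLp.coeFn_toLp (hTV (f + g)), MemLp.coeFn_toLp (hTV f),
          MemLp.coeFn_toLp (hTV g), Lp.coeFn_add (MemLp.toLp _ (hTV f)) (MemLp.toLp _ (hTV g)),
          Lp.coeFn_add (T f) (T g)] with x h1 h2 h3 h4 h5
        rw [h1, h4, Pi.add_apply, h2, h3, ← Pi.add_apply, ← h5, ← map_add]
        rfl
      map_smul' := fun c f => Lp.ext <| by
        filter_upwards [MemLp.coeFn_toLp (hTV (c • f)), MemLp.coeFn_toLp (hTV f),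
          Lp.coeFn_smul c (MemLp.toLp _ (hTV f)), Lp.coeFn_smul c (T f)] with x h1 h2 h3 h4
        rw [h1, RingHom.id_apply, h3, Pi.smul_apply, h2, ← Pi.smul_apply, ← h4, ← map_smul]
        rfl }
  have hdense : DenseRange e := by
    refine (Lp.simpleFunc.dense (E := 𝕜) (p := r) (μ := μ) hr).mono fun g hg => ?_
    have h1 := Lp.simpleFunc.memLp (⟨g, hg⟩ : Lp.simpleFunc 𝕜 r μ)
    have h2 := Lp.simpleFunc.toSimpleFunc_eq_toFun (⟨g, hg⟩ : Lp.simpleFunc 𝕜 r μ)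
    have h3 : MemLp (Lp.simpleFunc.toSimpleFunc (⟨g, hg⟩ : Lp.simpleFunc 𝕜 r μ)) p μ :=
      (SimpleFunc.memLp_iff_finMeasSupp hp0 hp).2 ((SimpleFunc.memLp_iff_finMeasSupp hr0 hr).1 h1)
    have h4 : MemLp h3.toLp r μ := h1.ae_eq h3.coeFn_toLp.symm
    exact ⟨⟨h3.toLp, h4⟩, Lp.ext ((MemLp.coeFn_toLp h4).trans (h3.coeFn_toLp.trans h2))⟩
  have hnorm : ∀ f : V, ‖F f‖ ≤ D * ‖e f‖ := fun f => by
    have h1 : ‖F f‖ = (eLpNorm (T f) r μ).toReal := Lp.norm_toLp _ (hTV f)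
    have h2 : ‖e f‖ = (eLpNorm f.1 r μ).toReal := Lp.norm_toLp _ f.2
    rw [h1, h2, ← ENNReal.toReal_ofReal hD, ← ENNReal.toReal_mul]
    exact ENNReal.toReal_mono (ENNReal.mul_ne_top ENNReal.ofReal_ne_top f.2.2.ne) (hT f)
  refine ⟨F.extendOfNorm e, fun f g hfg => ?_⟩
  have hf : MemLp f r μ := (Lp.memLp g).ae_eq hfg.symm
  have hg : e ⟨f, hf⟩ = g := Lp.ext ((MemLp.coeFn_toLp hf).trans hfg)
  rw [← hg, LinearMap.extendOfNorm_eq hdense ⟨D, hnorm⟩]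
  exact MemLp.coeFn_toLp (hTV ⟨f, hf⟩)

end RBMO

theorem theorem6p1 {𝕜 : Type*} [RCLike 𝕜] (d n : ℕ) (hn : 1 ≤ n) (hnd : n ≤ d)
    (μ : Measure (EuclideanSpace ℝ (Fin d)))
    (hμ : ∃ C₀ : ℝ, ∀ (x : EuclideanSpace ℝ (Fin d)) (s : ℝ), 0 < s →
      μ (Metric.ball x s) ≤ ENNReal.ofReal (C₀ * s ^ n))
    (β : ℝ) (hβ : 2 ^ d < β)
    (p r : ℝ≥0∞) [Fact (1 ≤ p)] [Fact (1 ≤ r)] (hp : 1 < p) (hpr : p < r) (hr : r < ∞)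
    (T : Lp 𝕜 p μ →L[𝕜] Lp 𝕜 p μ)
    (hT : ∃ A : ℝ, ∀ f : Lp 𝕜 p μ, MemLp f ∞ μ →
      MemRBMO μ n β (T f) ∧ rbmoNorm μ n β (T f) ≤ A * (eLpNorm f ∞ μ).toReal) :
    ∃ S : Lp 𝕜 r μ →L[𝕜] Lp 𝕜 r μ,
      ∀ (f : Lp 𝕜 p μ) (g : Lp 𝕜 r μ), f =ᵐ[μ] g → S g =ᵐ[μ] T f := by
  obtain ⟨C, hC, hG⟩ := RBMO.exists_hasGrowth hn hnd hμ
  obtain ⟨A, hA⟩ := hT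
  have hp_top : p ≠ ∞ := (hpr.trans hr).ne
  have hr0 : r ≠ 0 := (zero_lt_one.trans (hp.trans hpr)).ne'
  obtain ⟨D, hD, hbound⟩ := hG.exists_lintegral_rpow_le hC hnd hβ hp_top T hA
    ((ENNReal.toReal_lt_toReal hp_top hr.ne).2 hpr)
  have hD' : D ^ (1 / r.toReal) ≠ ∞ := ENNReal.rpow_ne_top_of_nonneg (by positivity) hD
  refine RBMO.exists_extension hp_top hr.ne T (D := (D ^ (1 / r.toReal)).toReal)
    ENNReal.toReal_nonneg fun f => ?_
  rw [ENNReal.ofReal_toReal hD', eLpNorm_eq_lintegral_rpow_enorm_toReal hr0 hr.ne,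
    eLpNorm_eq_lintegral_rpow_enorm_toReal hr0 hr.ne,
    ← ENNReal.mul_rpow_of_nonneg _ _ (by positivity)]
  exact ENNReal.rpow_le_rpow (hbound f) (by positivity)
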